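/- Let $\mathbb{S}^1=\mathbb{R}/2\pi\mathbb{Z}$ and let $|\theta-\theta'|$ denote the distance on $\mathbb{S}^1$. All functions below are defined on $\mathbb{S}^1$ with values in $\mathbb{R}^2$, and $|\cdot|$ is the Euclidean norm on $\mathbb{R}^2$. For an integer $k\ge 0$ and $0<\gamma<1$, let $C^{k,\gamma}(\mathbb{S}^1)$ be the space of $C^k$ functions whose $k$-th derivative is Hölder continuous with exponent $\gamma$, with norm $$\|u\|_{C^{k,\gamma}}=\sum_{l=0}^k\sup_{\theta}|\partial_\theta^l u(\theta)|+\sup_{0<|\theta-\theta'|<1}\frac{|\partial_\theta^k u(\theta)-\partial_\theta^k u(\theta')|}{|\theta-\theta'|^\gamma}.$$ For $X\in C^{1}(\mathbb{S}^1)$ put $|X|_*=\inf_{\theta\ne\theta'}\frac{|X(\theta)-X(\theta')|}{|\theta-\theta'|}$ and, with $\Delta X=X(\theta)-X(\theta')$, $$K_C(\theta,\theta')=\frac{\Delta X\cdot\partial_{\theta'}X(\theta')}{|\Delta X|^2}-\frac12\cot\Big(\frac{\theta-\theta'}2\Big),\qquad K_T(\theta,\theta')=\partial_{\theta'}\Big(\frac{\Delta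 X\otimes\Delta X}{|\Delta X|^2}\Big),$$ $$F_C[u](\theta)=-\frac1{4\pi}\int_{\mathbb{S}^1}K_C(\theta,\theta')u(\theta')\,d\theta',\qquad F_T[u](\theta)=-\frac1{4\pi}\int_{\mathbb{S}^1}K_T(\theta,\theta')u(\theta')\,d\theta'.$$ Let $\gamma\in(0,1)$. For all $X\in C^{1,\gamma}(\mathbb{S}^1)$ with $|X|_*>0$ and all $u\in C^{0,\gamma}(\mathbb{S}^1)$, the integrals defining $F_C[u](\theta)$ and $F_T[u](\theta)$ converge absolutely for every $\theta$. Moreover: (i) If $\gamma\ne 1/2$, there is a constant $C$ depending only on $\gamma$ such that, for all such $X$ and $u$, both $F=F_C$ and $F=F_T$ satisfy $F[u]\in C^{\lfloor 2\gamma\rfloor,\,2\gamma-\lfloor 2\gamma\rfloor}(\mathbb{S}^1)$ and $$\|F[u]\|_{C^{\lfloor 2\gamma\rfloor,\,2\gamma-\lfloor 2\gamma\rfloor}}\le C\,\frac{\|X\|_{C^{1,\gamma}}^3}{|X|_*^3}\,\|u\|_{C^{0,\gamma}}.$$ (ii) If $\gamma=1/2$, then for every $\alpha\in(0,1)$ there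 is a constant $C$ depending only on $\alpha$ such that, for all such $X$ and $u$, both $F=F_C$ and $F=F_T$ satisfy $F[u]\in C^{0,\alpha}(\mathbb{S}^1)$ and $$\|F[u]\|_{C^{0,\alpha}}\le C\,\frac{\|X\|_{C^{1,\gamma}}^3}{|X|_*^3}\,\|u\|_{C^{0,\gamma}}.$$ -/

import Mathlib

open Set MeasureTheory
open scoped Real

namespace Peskin

noncomputable section

/-- The plane with its Euclidean norm. -/
abbrev Plane : Type := EuclideanSpace ℝ (Fin 2)

/- Functions on the circle `ℝ / 2πℤ` are represented by `2π`-periodic functions on `ℝ`. -/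

/-- The space `C^{k,γ}` of plane-valued functions on the circle: the function is `2π`-periodic,
`k` times continuously differentiable, and its `k`-th derivative is Hölder continuous with
exponent `γ`. -/
def MemHolderSpace (k : ℕ) (γ : ℝ) (f : ℝ → Plane) : Prop :=
  Function.Periodic f (2 * π) ∧ ContDiff ℝ k f ∧
    ∃ K : ℝ, ∀ θ θ' : ℝ,
      ‖iteratedDeriv k f θ - iteratedDeriv k f θ'‖ ≤ K * |θ - θ'| ^ γ

/-- The norm of `C^k`: the sum of the suprema of the derivatives of order at most `k`. -/
def ckNorm (k : ℕ) (f : ℝ → Plane) : ℝ :=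
  ∑ l ∈ Finset.range (k + 1), ⨆ θ : ℝ, ‖iteratedDeriv l f θ‖

/-- The Hölder seminorm, the supremum of the Hölder quotients over points at distance
less than `1`. -/
def holderSeminorm (γ : ℝ) (f : ℝ → Plane) : ℝ :=
  sSup {r : ℝ | ∃ θ θ' : ℝ, θ ≠ θ' ∧ |θ - θ'| < 1 ∧ r = ‖f θ - f θ'‖ / |θ - θ'| ^ γ}

/-- The norm of `C^{k,γ}`. -/
def holderNorm (k : ℕ) (γ : ℝ) (f : ℝ → Plane) : ℝ :=
  ckNorm k f + holderSeminorm γ (iteratedDeriv k f)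

/-- The arc-chord quantity `|X|_*`: the infimum of `|X(θ) - X(θ')| / |θ - θ'|` over distinct
points of the circle, where `|θ - θ'|` is the distance on the circle. -/
def starNorm (X : ℝ → Plane) : ℝ :=
  sInf {r : ℝ | ∃ θ θ' : ℝ, (θ : AddCircle (2 * π)) ≠ (θ' : AddCircle (2 * π)) ∧
    r = ‖X θ - X θ'‖ / dist (θ : AddCircle (2 * π)) (θ' : AddCircle (2 * π))}

/-- The kernel `K_C(θ,θ') = ΔX · ∂_{θ'}X' / |ΔX|² - (1/2) cot((θ - θ')/2)`,
with `ΔX = X(θ) - X(θ')`. -/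
def kernelC (X : ℝ → Plane) (θ θ' : ℝ) : ℝ :=
  inner ℝ (X θ - X θ') (deriv X θ') / ‖X θ - X θ'‖ ^ 2 - 1 / 2 * Real.cot ((θ - θ') / 2)

/-- The matrix kernel `K_T(θ,θ') = ∂_{θ'} (ΔX ⊗ ΔX / |ΔX|²)`, entry by entry. -/
def kernelT (X : ℝ → Plane) (θ θ' : ℝ) : Matrix (Fin 2) (Fin 2) ℝ :=
  Matrix.of fun i j =>
    deriv (fun s : ℝ => (X θ - X s) i * (X θ - X s) j / ‖X θ - X s‖ ^ 2) θ'

/-- The integrand of `F_C[u](θ)`. -/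
def integrandC (X u : ℝ → Plane) (θ θ' : ℝ) : Plane :=
  kernelC X θ θ' • u θ'

/-- The integrand of `F_T[u](θ)`: the matrix `K_T(θ,θ')` applied to the vector `u(θ')`. -/
def integrandT (X u : ℝ → Plane) (θ θ' : ℝ) : Plane :=
  WithLp.toLp 2 (Matrix.mulVec (kernelT X θ θ') (u θ').ofLp)

/-- `F_C[u](θ) = -(1/4π) ∫ K_C(θ,θ') u(θ') dθ'`, the integral being over one period. -/
def opC (X u : ℝ → Plane) (θ : ℝ) : Plane :=
  -(1 / (4 * π)) • ∫ θ' in (0 : ℝ)..(2 * π), integrandC X u θ θ'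

/-- `F_T[u](θ) = -(1/4π) ∫ K_T(θ,θ') u(θ') dθ'`, the integral being over one period. -/
def opT (X u : ℝ → Plane) (θ : ℝ) : Plane :=
  -(1 / (4 * π)) • ∫ θ' in (0 : ℝ)..(2 * π), integrandT X u θ θ'

end

end Peskin

namespace Peskin

open scoped ComplexConjugate

section

/-! ### Integrals of truncated powers -/

/-! Identify the plane with `ℂ`, write `Z` for the curve and z = Z(θ) - Z(t). Then ΔX · X'(t) /
|ΔX|² is the real part of the Cauchy kernel Z'(t)/z, and half the cotangent is the same expression
for the unit circle. The matrix ΔX ⊗ ΔX / |ΔX|² is the projection onto the line of z, that is u ↦ (u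
+ (z/z̄) ū)/2, so K_T u = ½ ∂_t(z/z̄) ū. Both operators thus become scalar integral operators over
`ℂ`.

Two facts about these kernels carry the theorem. The first is regularity (`ArcChord.cauchy`,
`ArcChord.tensor`): Hölder continuity of Z' lowers the diagonal singularity to order γ - 1, the
θ-derivative has order γ - 2, and the first order Taylor remainder is at most a multiple of |η -
θ|^(1+γ) |θ - t|^(-2). Every constant is at most a multiple of the cube of (bound on Z')/(arc-chord
constant). The second is cancellation (`ArcChord.integral_tensorKernel`,
`ArcChord.integral_scalarKernel`): the kernels have mean zero in t, because their primitives z/z̄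
and -log|z|, suitably desingularized, are single valued on the circle.

By mean zero, F(η) - F(θ) is a multiple of the integral of (K(η,t) - K(θ,t))(u(t) - u(θ)), and the
second factor contributes another power γ. With δ = |η - θ|, the region |θ - t| ≤ 2δ gives O(δ^(2γ))
by size alone. In the far region the linear term is at most δ|θ - t|^(2γ-2). For γ < 1/2 its
integral is again O(δ^(2γ)). For γ > 1/2 the function |θ - t|^(2γ-2) is integrable at θ, so the
linear term is kept as the derivative of F and only the Taylor remainder is estimated; a first order
expansion with error O(δ^(2γ)) at every point gives C^(1,2γ-1). At γ = 1/2 the far integral is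
logarithmic, so the data are regarded as Hölder of exponent α/2 < 1/2 and the first case applies. -/

theorem integrable_comp_abs {f : ℝ → ℝ} (hf : IntegrableOn f (Ioi 0)) :
    Integrable fun x : ℝ => f |x| := by
  have h₁ : IntegrableOn (fun x : ℝ => f |x|) (Ioi 0) :=
    hf.congr_fun (fun x hx => by simp only [abs_of_pos (mem_Ioi.1 hx)]) measurableSet_Ioi
  have h₂ : IntegrableOn (fun x : ℝ => f |x|) (Iic 0) := by
    rw [← Measure.map_neg_eq_self (volume : Measure ℝ)]
    let m : MeasurableEmbedding fun x : ℝ => -x := (Homeomorph.neg ℝ).measurableEmbedding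
    rw [m.integrableOn_map_iff]
    simp_rw [Function.comp_def, abs_neg, neg_preimage, neg_Iic, neg_zero]
    exact Iff.mpr integrableOn_Ici_iff_integrableOn_Ioi h₁
  rw [← integrableOn_univ, ← Iic_union_Ioi (a := (0 : ℝ))]
  exact h₂.union h₁

/-- The power `|x| ^ e` cut off to `|x| ≤ r`. -/
noncomputable def nearPow (e r x : ℝ) : ℝ := (Iic r).indicator (fun y => y ^ e) |x|

/-- The power `|x| ^ e` cut off to `r < |x|`. -/
noncomputable def farPow (e r x : ℝ) : ℝ := (Ioi r).indicator (fun y => y ^ e) |x|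

theorem nearPow_nonneg (e r x : ℝ) : 0 ≤ nearPow e r x :=
  indicator_apply_nonneg fun _ => Real.rpow_nonneg (abs_nonneg x) e

theorem farPow_nonneg (e r x : ℝ) : 0 ≤ farPow e r x :=
  indicator_apply_nonneg fun _ => Real.rpow_nonneg (abs_nonneg x) e

theorem nearPow_of_le {e r x : ℝ} (h : |x| ≤ r) : nearPow e r x = |x| ^ e :=
  indicator_of_mem (s := Iic r) h _

theorem farPow_of_lt {e r x : ℝ} (h : r < |x|) : farPow e r x = |x| ^ e :=
  indicator_of_mem (s := Ioi r) h _

theorem integrable_nearPow {e r : ℝ} (he : -1 < e) (hr : 0 ≤ r) : Integrable (nearPow e r) := by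
  refine integrable_comp_abs ?_
  rw [IntegrableOn, integrable_indicator_iff measurableSet_Iic, IntegrableOn,
    Measure.restrict_restrict measurableSet_Iic, inter_comm, Ioi_inter_Iic]
  exact (intervalIntegrable_iff_integrableOn_Ioc_of_le hr).1
    (intervalIntegral.intervalIntegrable_rpow' he)

theorem integral_nearPow {e r : ℝ} (he : -1 < e) (hr : 0 ≤ r) :
    ∫ x, nearPow e r x = 2 * r ^ (e + 1) / (e + 1) := by
  unfold nearPow
  rw [integral_comp_abs, integral_indicator measurableSet_Iic,
    Measure.restrict_restrict measurableSet_Iic, inter_comm, Ioi_inter_Iic,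
    ← intervalIntegral.integral_of_le hr, integral_rpow (Or.inl he),
    Real.zero_rpow (by linarith), sub_zero, mul_div_assoc]

theorem integrable_farPow {e r : ℝ} (he : e < -1) (hr : 0 < r) : Integrable (farPow e r) := by
  refine integrable_comp_abs ?_
  rw [IntegrableOn, integrable_indicator_iff measurableSet_Ioi, IntegrableOn,
    Measure.restrict_restrict measurableSet_Ioi, inter_comm, Ioi_inter_Ioi, max_eq_right hr.le]
  exact integrableOn_Ioi_rpow_of_lt he hr

theorem integral_farPow {e r : ℝ} (he : e < -1) (hr : 0 < r) :
    ∫ x, farPow e r x = 2 * r ^ (e + 1) / (-(e + 1)) := by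
  unfold farPow
  rw [integral_comp_abs, integral_indicator measurableSet_Ioi,
    Measure.restrict_restrict measurableSet_Ioi, inter_comm, Ioi_inter_Ioi, max_eq_right hr.le,
    integral_Ioi_rpow_of_lt he hr, div_neg, mul_div_assoc, neg_div, mul_neg]

/-- The majorant is integrated over all of `ℝ`, so that truncated powers centred at either of two
points have explicit, translation invariant integrals. The exceptional points are meant for θ and η,
where the kernel bounds say nothing. -/
theorem norm_intervalIntegral_le_integral {f : ℝ → ℂ} {g : ℝ → ℝ} {a b : ℝ} (p q : ℝ) (hab : a ≤ b)
    (hg : Integrable g) (hg0 : ∀ t, 0 ≤ g t)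
    (h : ∀ t ∈ Ioc a b, t ≠ p → t ≠ q → ‖f t‖ ≤ g t) :
    ‖∫ t in a..b, f t‖ ≤ ∫ t, g t := by
  have hp : ∀ᵐ t : ℝ, t ≠ p := by simp [ae_iff, measure_singleton]
  have hq : ∀ᵐ t : ℝ, t ≠ q := by simp [ae_iff, measure_singleton]
  refine (intervalIntegral.norm_integral_le_of_norm_le hab ?_ hg.intervalIntegrable).trans ?_
  · filter_upwards [hp, hq] with t h₁ h₂ ht using h t ht h₁ h₂
  · rw [intervalIntegral.integral_of_le hab]
    exact setIntegral_le_integral hg (Filter.Eventually.of_forall hg0)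

theorem intervalIntegrable_of_norm_le {f : ℝ → ℂ} {g : ℝ → ℝ} {a b : ℝ} (p q : ℝ) (hab : a ≤ b)
    (hf : Measurable f) (hg : Integrable g)
    (h : ∀ t ∈ Ioc a b, t ≠ p → t ≠ q → ‖f t‖ ≤ g t) :
    IntervalIntegrable f volume a b := by
  have hp : ∀ᵐ t : ℝ, t ≠ p := by simp [ae_iff, measure_singleton]
  have hq : ∀ᵐ t : ℝ, t ≠ q := by simp [ae_iff, measure_singleton]
  rw [intervalIntegrable_iff_integrableOn_Ioc_of_le hab]
  refine Integrable.mono' hg.integrableOn hf.aestronglyMeasurable ?_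
  rw [ae_restrict_iff' measurableSet_Ioc]
  filter_upwards [hp, hq] with t h₁ h₂ ht using h t ht h₁ h₂

/-! ### Singular integral operators -/

/-- A kernel `K` of order `γ - 1` on the diagonal which has, in its first variable, a derivative
`K₁` of order `γ - 2` with a Hölder estimate on the remainder. -/
structure SingularKernel (γ M : ℝ) (K K₁ : ℝ → ℝ → ℂ) : Prop where
  measurable : ∀ θ, Measurable (K θ)
  measurable_deriv : ∀ θ, Measurable (K₁ θ)
  bound : ∀ θ t, θ ≠ t → |θ - t| ≤ 3 * π / 2 → ‖K θ t‖ ≤ M * |θ - t| ^ (γ - 1)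
  bound_deriv : ∀ θ t, θ ≠ t → |θ - t| ≤ π → ‖K₁ θ t‖ ≤ M * |θ - t| ^ (γ - 2)
  taylor : ∀ θ η t, θ ≠ η → 2 * |η - θ| ≤ |θ - t| → |θ - t| ≤ π →
    ‖K η t - K θ t - ((η - θ : ℝ) : ℂ) * K₁ θ t‖ ≤ M * (|η - θ| ^ (1 + γ) * |θ - t| ^ (-2 : ℝ))

/-- A bounded Hölder continuous density. -/
structure HolderDensity (γ B : ℝ) (u : ℝ → ℂ) : Prop where
  continuous : Continuous u
  bound : ∀ t, ‖u t‖ ≤ B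
  holder : ∀ a b, ‖u a - u b‖ ≤ B * |a - b| ^ γ

variable {γ M B : ℝ} {K K₁ : ℝ → ℝ → ℂ} {u : ℝ → ℂ}

theorem SingularKernel.nonneg (hK : SingularKernel γ M K K₁) : 0 ≤ M := by
  have h := (norm_nonneg _).trans
    (hK.bound 1 0 one_ne_zero (by rw [sub_zero, abs_one]; linarith [Real.pi_gt_three]))
  simpa using h

theorem HolderDensity.nonneg (hu : HolderDensity γ B u) : 0 ≤ B :=
  (norm_nonneg _).trans (hu.bound 0)

theorem abs_sub_le_pi {θ t : ℝ} (ht : t ∈ Ioc (θ - π) (θ + π)) : |θ - t| ≤ π := by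
  rw [abs_le]; constructor <;> linarith [ht.1, ht.2]

theorem SingularKernel.intervalIntegrable (hK : SingularKernel γ M K K₁) (hγ : 0 < γ) (θ : ℝ) :
    IntervalIntegrable (K θ) volume (θ - π) (θ + π) := by
  have hπ := Real.pi_pos
  refine intervalIntegrable_of_norm_le θ θ (by linarith) (hK.measurable θ)
    (((integrable_nearPow (e := γ - 1) (by linarith) hπ.le).comp_sub_left θ).const_mul M) ?_
  intro t ht hne _
  have h := abs_sub_le_pi ht
  rw [nearPow_of_le h]
  exact hK.bound θ t hne.symm (by linarith)

theorem SingularKernel.intervalIntegrable_mul (hK : SingularKernel γ M K K₁) (hγ : 0 < γ)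
    (hu : Continuous u) (θ : ℝ) :
    IntervalIntegrable (fun t => K θ t * u t) volume (θ - π) (θ + π) :=
  (hK.intervalIntegrable hγ θ).mul_continuousOn hu.continuousOn

theorem SingularKernel.norm_integral_le (hK : SingularKernel γ M K K₁) (hγ : 0 < γ)
    (hu : HolderDensity γ B u) (θ : ℝ) :
    ‖∫ t in (θ - π)..(θ + π), K θ t * u t‖ ≤ 2 * π ^ γ / γ * (M * B) := by
  have hπ := Real.pi_pos
  have hM := hK.nonneg
  have hB := hu.nonneg
  have hint := (integrable_nearPow (e := γ - 1) (by linarith) hπ.le).comp_sub_left θ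
  refine (norm_intervalIntegral_le_integral θ θ (by linarith) (hint.const_mul (M * B))
    (fun t => mul_nonneg (by positivity) (nearPow_nonneg _ _ _)) ?_).trans ?_
  · intro t ht hne _
    have h := abs_sub_le_pi ht
    rw [nearPow_of_le h, norm_mul]
    calc ‖K θ t‖ * ‖u t‖ ≤ (M * |θ - t| ^ (γ - 1)) * B :=
          mul_le_mul (hK.bound θ t hne.symm (by linarith)) (hu.bound t) (norm_nonneg _)
            (by positivity)
      _ = M * B * |θ - t| ^ (γ - 1) := by ring
  · rw [integral_const_mul, integral_sub_left_eq_self (nearPow (γ - 1) π) volume θ,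
      integral_nearPow (by linarith) hπ.le, sub_add_cancel]
    exact le_of_eq (by ring)

theorem intervalIntegral_eq_centered {f : ℝ → ℂ} (hf : Function.Periodic f (2 * π)) (θ η : ℝ) :
    ∫ t in (θ - π)..(θ + π), f t = ∫ t in (η - π)..(η + π), f t := by
  have h := hf.intervalIntegral_add_eq (θ - π) (η - π)
  rwa [show θ - π + 2 * π = θ + π by ring, show η - π + 2 * π = η + π by ring] at h

/-- The increment of a singular integral with a kernel of mean zero. -/
theorem SingularKernel.sub_eq (hK : SingularKernel γ M K K₁) (hγ : 0 < γ)
    (hper : ∀ θ, Function.Periodic (K θ) (2 * π))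
    (hzero : ∀ θ, ∫ t in (θ - π)..(θ + π), K θ t = 0)
    (hu : Continuous u) (huper : Function.Periodic u (2 * π)) (θ η : ℝ) :
    (∫ t in (η - π)..(η + π), K η t * u t) - ∫ t in (θ - π)..(θ + π), K θ t * u t =
      ∫ t in (θ - π)..(θ + π), (K η t - K θ t) * (u t - u θ) := by
  have hp : Function.Periodic (fun t => K η t * u t) (2 * π) := fun t => by
    simp only [hper η t, huper t]
  have hi : ∀ {f : ℝ → ℂ}, Function.Periodic f (2 * π) →
      IntervalIntegrable f volume (η - π) (η + π) →
      IntervalIntegrable f volume (θ - π) (θ + π) := fun hf h =>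
    hf.intervalIntegrable (t := η - π) (by positivity)
      (by rwa [show η - π + 2 * π = η + π by ring]) _ _
  -- Mean zero of `K η` is given on its own centred period; periodicity moves it to the one around
  -- θ. This is what permits subtracting the constant `u θ` in both integrals.
  have hz : ∫ t in (θ - π)..(θ + π), K η t = 0 := by
    rw [intervalIntegral_eq_centered (hper η) θ η, hzero]
  have h₁ := hi hp (hK.intervalIntegrable_mul hγ hu η)
  have h₂ := hi (hper η) (hK.intervalIntegrable hγ η)
  have h₃ := hK.intervalIntegrable_mul hγ hu θ
  have h₄ := hK.intervalIntegrable hγ θ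
  have e : (fun t => (K η t - K θ t) * (u t - u θ)) =
      fun t => (K η t * u t - K θ t * u t) - (K η t * u θ - K θ t * u θ) := by
    funext t; ring
  rw [e, intervalIntegral.integral_sub (h₁.sub h₃) ((h₂.mul_const _).sub (h₄.mul_const _)),
    intervalIntegral.integral_sub h₁ h₃,
    intervalIntegral.integral_sub (h₂.mul_const _) (h₄.mul_const _),
    intervalIntegral.integral_mul_const, intervalIntegral.integral_mul_const, hz, hzero,
    intervalIntegral_eq_centered hp η θ]
  ring

/-- Near the diagonal the two kernels are estimated separately. -/
theorem SingularKernel.norm_near_le (hK : SingularKernel γ M K K₁) (hγ : 0 < γ)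
    (hu : HolderDensity γ B u) {θ η t : ℝ} (hd : |η - θ| ≤ 1) (h₁ : t ≠ θ) (h₂ : t ≠ η)
    (hn : |θ - t| ≤ 2 * |η - θ|) :
    ‖(K η t - K θ t) * (u t - u θ)‖ ≤
      M * B * (2 * |η - θ|) ^ γ * nearPow (γ - 1) (3 * |η - θ|) (η - t) +
        M * B * nearPow (2 * γ - 1) (2 * |η - θ|) (θ - t) := by
  have hM := hK.nonneg
  have hB := hu.nonneg
  have hπ := Real.pi_gt_three
  have hη : |η - t| ≤ 3 * |η - θ| := by
    calc |η - t| ≤ |η - θ| + |θ - t| := abs_sub_le _ _ _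
      _ ≤ _ := by linarith
  rw [nearPow_of_le hη, nearPow_of_le hn, sub_mul]
  have hu' : ‖u t - u θ‖ ≤ B * |θ - t| ^ γ := by
    rw [abs_sub_comm]; exact hu.holder t θ
  -- The factor `u t - u θ` vanishes at θ, not at η. Against `K η` it is therefore only bounded by
  -- its maximum on the near region; against `K θ` the two powers combine to exponent 2γ - 1.
  refine (norm_sub_le _ _).trans (add_le_add ?_ ?_)
  · rw [norm_mul]
    calc ‖K η t‖ * ‖u t - u θ‖ ≤ (M * |η - t| ^ (γ - 1)) * (B * (2 * |η - θ|) ^ γ) :=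
          mul_le_mul (hK.bound η t h₂.symm (by linarith)) (hu'.trans (by gcongr))
            (norm_nonneg _) (by positivity)
      _ = _ := by ring
  · rw [norm_mul]
    have hpos : 0 < |θ - t| := abs_pos.2 (sub_ne_zero.2 h₁.symm)
    calc ‖K θ t‖ * ‖u t - u θ‖ ≤ (M * |θ - t| ^ (γ - 1)) * (B * |θ - t| ^ γ) :=
          mul_le_mul (hK.bound θ t h₁.symm (by linarith)) hu' (norm_nonneg _) (by positivity)
      _ = M * B * (|θ - t| ^ (γ - 1) * |θ - t| ^ γ) := by ring
      _ = _ := by rw [← Real.rpow_add hpos]; ring_nf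

/-- Below the critical exponent a singular integral gains one power `γ`. -/
theorem SingularKernel.holder_of_lt_half (hγ : 0 < γ) (hγ2 : γ < 1 / 2) :
    ∃ C : ℝ, 0 ≤ C ∧ ∀ (M B : ℝ) (K K₁ : ℝ → ℝ → ℂ) (u : ℝ → ℂ), SingularKernel γ M K K₁ →
      HolderDensity γ B u → ∀ θ η : ℝ, θ ≠ η → |η - θ| ≤ 1 →
      ‖∫ t in (θ - π)..(θ + π), (K η t - K θ t) * (u t - u θ)‖ ≤
        C * (M * B) * |η - θ| ^ (2 * γ) := by
  -- The three summands are the integrals of the majorants for `K η` near, `K θ` near, and the far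
  -- region. The last converges at infinity because 2γ - 2 < -1.
  refine ⟨2 ^ γ * (2 * 3 ^ γ / γ) + 2 * 2 ^ (2 * γ) / (2 * γ) +
    2 * (2 * 2 ^ (2 * γ - 1) / (1 - 2 * γ)), ?_, ?_⟩
  · have : 0 < 1 - 2 * γ := by linarith
    positivity
  intro M B K K₁ u hK hu θ η hne hd
  have hM := hK.nonneg
  have hB := hu.nonneg
  have hπ := Real.pi_gt_three
  have hδ : 0 < |η - θ| := abs_pos.2 (sub_ne_zero.2 hne.symm)
  set δ := |η - θ| with hδdef
  have i₁ := (integrable_nearPow (e := γ - 1) (r := 3 * δ) (by linarith) (by positivity))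
  have i₂ := (integrable_nearPow (e := 2 * γ - 1) (r := 2 * δ) (by linarith) (by positivity))
  have i₃ := (integrable_farPow (e := 2 * γ - 2) (r := 2 * δ) (by linarith) (by positivity))
  have j₁ := (i₁.comp_sub_left η).const_mul (M * B * (2 * δ) ^ γ)
  have j₂ := (i₂.comp_sub_left θ).const_mul (M * B)
  have j₃ := (i₃.comp_sub_left θ).const_mul (2 * (M * B) * δ)
  refine (norm_intervalIntegral_le_integral θ η (by linarith) ((j₁.add j₂).add j₃) ?_ ?_).trans ?_
  · intro t
    have := nearPow_nonneg (γ - 1) (3 * δ) (η - t)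
    have := nearPow_nonneg (2 * γ - 1) (2 * δ) (θ - t)
    have := farPow_nonneg (2 * γ - 2) (2 * δ) (θ - t)
    simp only [Pi.add_apply]
    positivity
  · intro t ht h₁ h₂
    simp only [Pi.add_apply]
    rcases le_or_gt |θ - t| (2 * δ) with hn | hn
    · have := hK.norm_near_le hγ hu hd h₁ h₂ hn
      have h3 := farPow_nonneg (2 * γ - 2) (2 * δ) (θ - t)
      have : 0 ≤ 2 * (M * B) * δ * farPow (2 * γ - 2) (2 * δ) (θ - t) := by positivity
      linarith
    · have h1 := nearPow_nonneg (γ - 1) (3 * δ) (η - t)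
      have h2 := nearPow_nonneg (2 * γ - 1) (2 * δ) (θ - t)
      have h1 : 0 ≤ M * B * (2 * δ) ^ γ * nearPow (γ - 1) (3 * δ) (η - t) := by positivity
      have h2 : 0 ≤ M * B * nearPow (2 * γ - 1) (2 * δ) (θ - t) := by positivity
      have hpos : 0 < |θ - t| := by linarith
      have hlp := abs_sub_le_pi ht
      have htay := hK.taylor θ η t hne hn.le hlp
      have hder := hK.bound_deriv θ t h₁.symm hlp
      -- Far from the diagonal δ^γ ≤ |θ - t|^γ, so the Taylor remainder is no larger than the linear
      -- term.
      have hpow : δ ^ (1 + γ) * |θ - t| ^ (-2 : ℝ) ≤ δ * |θ - t| ^ (γ - 2) := by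
        rw [Real.rpow_add hδ, Real.rpow_one, show γ - 2 = γ + -2 by ring, Real.rpow_add hpos, mul_assoc]
        gcongr
        linarith
      have hdiff : ‖K η t - K θ t‖ ≤ 2 * M * δ * |θ - t| ^ (γ - 2) := by
        calc ‖K η t - K θ t‖ = ‖(K η t - K θ t - ((η - θ : ℝ) : ℂ) * K₁ θ t) +
              ((η - θ : ℝ) : ℂ) * K₁ θ t‖ := by congr 1; ring
          _ ≤ M * (δ * |θ - t| ^ (γ - 2)) + δ * (M * |θ - t| ^ (γ - 2)) := by
            refine (norm_add_le _ _).trans (add_le_add (htay.trans (by gcongr)) ?_)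
            rw [norm_mul, Complex.norm_real, Real.norm_eq_abs]
            gcongr
          _ = _ := by ring
      have hu' : ‖u t - u θ‖ ≤ B * |θ - t| ^ γ := by
        rw [abs_sub_comm]; exact hu.holder t θ
      have : ‖(K η t - K θ t) * (u t - u θ)‖ ≤
          2 * (M * B) * δ * farPow (2 * γ - 2) (2 * δ) (θ - t) := by
        rw [farPow_of_lt hn, norm_mul]
        calc _ ≤ (2 * M * δ * |θ - t| ^ (γ - 2)) * (B * |θ - t| ^ γ) := by gcongr
          _ = 2 * (M * B) * δ * (|θ - t| ^ (γ - 2) * |θ - t| ^ γ) := by ring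
          _ = _ := by rw [← Real.rpow_add hpos]; ring_nf
      linarith
  · rw [integral_add' (j₁.add j₂) j₃, integral_add' j₁ j₂, integral_const_mul, integral_const_mul,
      integral_const_mul, integral_sub_left_eq_self (nearPow (γ - 1) _) volume η,
      integral_sub_left_eq_self (nearPow (2 * γ - 1) _) volume θ,
      integral_sub_left_eq_self (farPow (2 * γ - 2) _) volume θ,
      integral_nearPow (by linarith) (by positivity),
      integral_nearPow (by linarith) (by positivity),
      integral_farPow (by linarith) (by positivity),
      show γ - 1 + 1 = γ by ring, show 2 * γ - 1 + 1 = 2 * γ by ring,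
      show 2 * γ - 2 + 1 = 2 * γ - 1 by ring, show -(2 * γ - 1) = 1 - 2 * γ by ring,
      Real.mul_rpow two_pos.le hδ.le, Real.mul_rpow three_pos.le hδ.le,
      Real.mul_rpow two_pos.le hδ.le, Real.mul_rpow two_pos.le hδ.le,
      Real.rpow_sub_one hδ.ne' (2 * γ), two_mul γ, Real.rpow_add hδ]
    refine le_of_eq ?_
    field_simp

/-- Above the critical exponent a singular integral has a first order Taylor expansion. -/
theorem SingularKernel.taylor_of_half_lt (hγ2 : 1 / 2 < γ) (hγ1 : γ < 1) :
    ∃ C : ℝ, 0 ≤ C ∧ ∀ (M B : ℝ) (K K₁ : ℝ → ℝ → ℂ) (u : ℝ → ℂ), SingularKernel γ M K K₁ →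
      HolderDensity γ B u → ∀ θ : ℝ, ∃ D : ℂ, ‖D‖ ≤ C * (M * B) ∧
      ∀ η : ℝ, θ ≠ η → |η - θ| ≤ 1 →
      ‖(∫ t in (θ - π)..(θ + π), (K η t - K θ t) * (u t - u θ)) - ((η - θ : ℝ) : ℂ) * D‖ ≤
        C * (M * B) * |η - θ| ^ (2 * γ) := by
  have hγ : 0 < γ := by linarith
  have hγ3 : 0 < 2 * γ - 1 := by linarith
  have hγ4 : 0 < 1 - γ := by linarith
  have hπ := Real.pi_gt_three
  -- `C₁` bounds the derivative and `C₂` collects the four majorants of the expansion error: two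
  -- kernels near, linear term near, Taylor remainder far.
  set C₁ : ℝ := 2 * π ^ (2 * γ - 1) / (2 * γ - 1) with hC₁
  set C₂ : ℝ := 2 ^ γ * (2 * 3 ^ γ / γ) + 2 * 2 ^ (2 * γ) / (2 * γ) +
    2 * 2 ^ (2 * γ - 1) / (2 * γ - 1) + 2 * 2 ^ (γ - 1) / (1 - γ) with hC₂
  have hC₁0 : 0 ≤ C₁ := by positivity
  have hC₂0 : 0 ≤ C₂ := by positivity
  refine ⟨C₁ + C₂, by positivity, ?_⟩
  intro M B K K₁ u hK hu θ
  have hM := hK.nonneg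
  have hB := hu.nonneg
  have hu' : ∀ t, ‖u t - u θ‖ ≤ B * |θ - t| ^ γ := fun t => by
    rw [abs_sub_comm]; exact hu.holder t θ
  have hK₁u : ∀ t, t ≠ θ → |θ - t| ≤ π →
      ‖K₁ θ t * (u t - u θ)‖ ≤ M * B * |θ - t| ^ (2 * γ - 2) := by
    intro t h₁ hlp
    have hpos : 0 < |θ - t| := abs_pos.2 (sub_ne_zero.2 h₁.symm)
    rw [norm_mul]
    calc _ ≤ (M * |θ - t| ^ (γ - 2)) * (B * |θ - t| ^ γ) :=
          mul_le_mul (hK.bound_deriv θ t h₁.symm hlp) (hu' t) (norm_nonneg _) (by positivity)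
      _ = M * B * (|θ - t| ^ (γ - 2) * |θ - t| ^ γ) := by ring
      _ = _ := by rw [← Real.rpow_add hpos]; ring_nf
  have iπ := ((integrable_nearPow (e := 2 * γ - 2) (r := π) (by linarith)
    (by positivity)).comp_sub_left θ).const_mul (M * B)
  have hI₁ : IntervalIntegrable (fun t => K₁ θ t * (u t - u θ)) volume (θ - π) (θ + π) := by
    refine intervalIntegrable_of_norm_le θ θ (by linarith)
      ((hK.measurable_deriv θ).mul (hu.continuous.measurable.sub_const _)) iπ ?_
    intro t ht h₁ _
    have hlp := abs_sub_le_pi ht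
    rw [nearPow_of_le hlp]
    exact hK₁u t h₁ hlp
  -- The candidate derivative comes from formally differentiating the kernel under the integral. It
  -- converges absolutely because the integrand has order 2γ - 2 > -1.
  refine ⟨∫ t in (θ - π)..(θ + π), K₁ θ t * (u t - u θ), ?_, ?_⟩
  · refine (norm_intervalIntegral_le_integral θ θ (by linarith) iπ
      (fun t => mul_nonneg (by positivity) (nearPow_nonneg _ _ _)) ?_).trans ?_
    · intro t ht h₁ _
      have hlp := abs_sub_le_pi ht
      rw [nearPow_of_le hlp]
      exact hK₁u t h₁ hlp
    · rw [integral_const_mul, integral_sub_left_eq_self (nearPow (2 * γ - 2) _) volume θ,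
        integral_nearPow (by linarith) (by positivity), show 2 * γ - 2 + 1 = 2 * γ - 1 by ring]
      rw [← hC₁, mul_comm]
      gcongr
      linarith
  intro η hne hd
  have hδ : 0 < |η - θ| := abs_pos.2 (sub_ne_zero.2 hne.symm)
  have hI₂ : IntervalIntegrable (fun t => (K η t - K θ t) * (u t - u θ)) volume
      (θ - π) (θ + π) := by
    have i₀ := (((integrable_nearPow (e := γ - 1) (r := 3 * π / 2) (by linarith)
      (by positivity)).comp_sub_left η).const_mul M)
    have h₁ : IntervalIntegrable (K η) volume (θ - π) (θ + π) := by
      refine intervalIntegrable_of_norm_le η η (by linarith) (hK.measurable η) i₀ ?_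
      intro t ht h₁ _
      -- The displaced point η can be farther than π from t; this is why the size bound is required
      -- up to 3π/2.
      have hη : |η - t| ≤ 3 * π / 2 := by
        calc |η - t| ≤ |η - θ| + |θ - t| := abs_sub_le _ _ _
          _ ≤ 1 + π := add_le_add hd (abs_sub_le_pi ht)
          _ ≤ _ := by linarith
      rw [nearPow_of_le hη]
      exact hK.bound η t h₁.symm hη
    exact (h₁.sub (hK.intervalIntegrable hγ θ)).mul_continuousOn
      (hu.continuous.sub continuous_const).continuousOn
  rw [← intervalIntegral.integral_const_mul,
    ← intervalIntegral.integral_sub hI₂ (hI₁.const_mul _)]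
  set δ := |η - θ| with hδdef
  have i₁ := (integrable_nearPow (e := γ - 1) (r := 3 * δ) (by linarith) (by positivity))
  have i₂ := (integrable_nearPow (e := 2 * γ - 1) (r := 2 * δ) (by linarith) (by positivity))
  have i₃ := (integrable_nearPow (e := 2 * γ - 2) (r := 2 * δ) (by linarith) (by positivity))
  have i₄ := (integrable_farPow (e := γ - 2) (r := 2 * δ) (by linarith) (by positivity))
  have j₁ := (i₁.comp_sub_left η).const_mul (M * B * (2 * δ) ^ γ)
  have j₂ := (i₂.comp_sub_left θ).const_mul (M * B)
  have j₃ := (i₃.comp_sub_left θ).const_mul (M * B * δ)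
  have j₄ := (i₄.comp_sub_left θ).const_mul (M * B * δ ^ (1 + γ))
  refine (norm_intervalIntegral_le_integral θ η (by linarith)
    (((j₁.add j₂).add j₃).add j₄) ?_ ?_).trans ?_
  · intro t
    have := nearPow_nonneg (γ - 1) (3 * δ) (η - t)
    have := nearPow_nonneg (2 * γ - 1) (2 * δ) (θ - t)
    have := nearPow_nonneg (2 * γ - 2) (2 * δ) (θ - t)
    have := farPow_nonneg (γ - 2) (2 * δ) (θ - t)
    simp only [Pi.add_apply]
    positivity
  · intro t ht h₁ h₂
    simp only [Pi.add_apply]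
    have hlp := abs_sub_le_pi ht
    rcases le_or_gt |θ - t| (2 * δ) with hn | hn
    · have a₁ := hK.norm_near_le hγ hu hd h₁ h₂ hn
      have h3 := farPow_nonneg (γ - 2) (2 * δ) (θ - t)
      have a₂ : 0 ≤ M * B * δ ^ (1 + γ) * farPow (γ - 2) (2 * δ) (θ - t) := by positivity
      -- Near the diagonal there is no Taylor estimate, so the linear term is paid for separately;
      -- its integral is δ · δ^(2γ-1).
      have a₃ : ‖((η - θ : ℝ) : ℂ) * (K₁ θ t * (u t - u θ))‖ ≤
          M * B * δ * nearPow (2 * γ - 2) (2 * δ) (θ - t) := by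
        rw [nearPow_of_le hn, norm_mul, Complex.norm_real, Real.norm_eq_abs, ← hδdef]
        calc _ ≤ δ * (M * B * |θ - t| ^ (2 * γ - 2)) := by gcongr; exact hK₁u t h₁ hlp
          _ = _ := by ring
      refine (norm_sub_le _ _).trans ?_
      linarith
    · have h1 := nearPow_nonneg (γ - 1) (3 * δ) (η - t)
      have h2 := nearPow_nonneg (2 * γ - 1) (2 * δ) (θ - t)
      have h3 := nearPow_nonneg (2 * γ - 2) (2 * δ) (θ - t)
      have h1 : 0 ≤ M * B * (2 * δ) ^ γ * nearPow (γ - 1) (3 * δ) (η - t) := by positivity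
      have h2 : 0 ≤ M * B * nearPow (2 * γ - 1) (2 * δ) (θ - t) := by positivity
      have h3 : 0 ≤ M * B * δ * nearPow (2 * γ - 2) (2 * δ) (θ - t) := by positivity
      have hpos : 0 < |θ - t| := by linarith
      have htay := hK.taylor θ η t hne hn.le hlp
      have : ‖(K η t - K θ t) * (u t - u θ) - ((η - θ : ℝ) : ℂ) * (K₁ θ t * (u t - u θ))‖ ≤
          M * B * δ ^ (1 + γ) * farPow (γ - 2) (2 * δ) (θ - t) := by
        rw [farPow_of_lt hn, ← mul_assoc, ← sub_mul, norm_mul]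
        calc _ ≤ (M * (δ ^ (1 + γ) * |θ - t| ^ (-2 : ℝ))) * (B * |θ - t| ^ γ) := by
              gcongr
              exact hu' t
          _ = M * B * δ ^ (1 + γ) * (|θ - t| ^ (-2 : ℝ) * |θ - t| ^ γ) := by ring
          _ = _ := by rw [← Real.rpow_add hpos]; ring_nf
      linarith
  · rw [integral_add' ((j₁.add j₂).add j₃) j₄, integral_add' (j₁.add j₂) j₃, integral_add' j₁ j₂,
      integral_const_mul, integral_const_mul, integral_const_mul, integral_const_mul,
      integral_sub_left_eq_self (nearPow (γ - 1) _) volume η,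
      integral_sub_left_eq_self (nearPow (2 * γ - 1) _) volume θ,
      integral_sub_left_eq_self (nearPow (2 * γ - 2) _) volume θ,
      integral_sub_left_eq_self (farPow (γ - 2) _) volume θ,
      integral_nearPow (by linarith) (by positivity),
      integral_nearPow (by linarith) (by positivity),
      integral_nearPow (by linarith) (by positivity),
      integral_farPow (by linarith) (by positivity),
      show γ - 1 + 1 = γ by ring, show 2 * γ - 1 + 1 = 2 * γ by ring,
      show 2 * γ - 2 + 1 = 2 * γ - 1 by ring, show γ - 2 + 1 = γ - 1 by ring,
      show -(γ - 1) = 1 - γ by ring,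
      Real.mul_rpow two_pos.le hδ.le, Real.mul_rpow three_pos.le hδ.le,
      Real.mul_rpow two_pos.le hδ.le, Real.mul_rpow two_pos.le hδ.le,
      Real.mul_rpow two_pos.le hδ.le, Real.rpow_sub_one hδ.ne' (2 * γ),
      Real.rpow_sub_one hδ.ne' γ]
    have e : C₂ * (M * B) * δ ^ (2 * γ) ≤ (C₁ + C₂) * (M * B) * δ ^ (2 * γ) := by
      gcongr
      linarith
    refine le_trans (le_of_eq ?_) e
    rw [hC₂, two_mul γ, Real.rpow_add hδ, Real.rpow_add hδ, Real.rpow_one]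
    field_simp

end

section

/-! ### Algebraic estimates -/

theorem norm_div_le_of_le {x y : ℂ} {p s H : ℝ} (hs : 0 < s) (hH : 0 < H) (hx : ‖x‖ ≤ p)
    (hy : s * H ≤ ‖y‖) : ‖x / y‖ ≤ p / s / H := by
  have hp : 0 ≤ p := (norm_nonneg _).trans hx
  rw [norm_div, div_div]
  exact div_le_div₀ hp hx (by positivity) hy

/-- In this and the following estimates `a` is a secant Z(θ) - Z(t), `h` the increment θ - t, `w`
the tangent at t and `e` = |h|^γ. The difference equals -((a - h w)/h)/a, so only the deviation of
the secant from the tangent enters. -/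
theorem norm_div_sub_inv_le {w a h : ℂ} {A s e : ℝ} (hs : 0 < s) (hh : h ≠ 0)
    (ha : s * ‖h‖ ≤ ‖a‖) (haw : ‖a - h * w‖ ≤ A * e * ‖h‖) :
    ‖w / a - 1 / h‖ ≤ A / s * e / ‖h‖ := by
  have hH : 0 < ‖h‖ := norm_pos_iff.2 hh
  have ha0 : a ≠ 0 := norm_pos_iff.1 (lt_of_lt_of_le (by positivity) ha)
  rw [show w / a - 1 / h = -(((a - h * w) / h) / a) by field_simp; ring, norm_neg]
  refine (norm_div_le_of_le (p := A * e) hs hH ?_ ha).trans (le_of_eq (by ring))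
  rw [norm_div, div_le_iff₀ hH]
  exact haw

/-- Here `q` = b - a is the displacement of the curve from θ to η, `v` the tangent at θ and `f` =
|δ|^γ. The second order remainders of w/(a + q) and 1/(h + δ) are (q/a)² w/b and (δ/h)²/(h + δ).
Their difference splits into factors that are each small by the estimates above; replacing q by δ v
in the linear term costs a multiple of q - δ v. -/
theorem cauchy_taylor {a b q w v h δ : ℂ} {A s e f : ℝ} (hs : 0 < s) (hsA : s ≤ A)
    (he : 0 ≤ e) (hf : 0 ≤ f) (hb : b = a + q) (hh : h ≠ 0) (hδ : 2 * ‖δ‖ ≤ ‖h‖)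
    (hw : ‖w‖ ≤ A) (has : s * ‖h‖ ≤ ‖a‖) (hbs : s * ‖h + δ‖ ≤ ‖b‖)
    (haw : ‖a - h * w‖ ≤ A * e * ‖h‖) (hbw : ‖b - (h + δ) * w‖ ≤ 2 * A * e * ‖h + δ‖)
    (hqw : ‖q - δ * w‖ ≤ 2 * A * e * ‖δ‖) (hqv : ‖q - δ * v‖ ≤ A * f * ‖δ‖)
    (hq : ‖q‖ ≤ A * ‖δ‖) (hef : e * ‖δ‖ ≤ f * ‖h‖) :
    ‖(w / b - 1 / (h + δ)) - (w / a - 1 / h) - δ * (-(w * v) / a ^ 2 + 1 / h ^ 2)‖ ≤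
      17 * (A / s) ^ 3 * (f * ‖δ‖ / ‖h‖ ^ 2) := by
  have hH : 0 < ‖h‖ := norm_pos_iff.2 hh
  have hA : 0 < A := by linarith
  have hhδ : ‖h‖ / 2 ≤ ‖h + δ‖ := by
    have := norm_sub_le (h + δ) δ
    rw [add_sub_cancel_right] at this
    linarith
  have hhδ0 : 0 < ‖h + δ‖ := by linarith
  have hhδne : h + δ ≠ 0 := norm_pos_iff.1 hhδ0
  have ha0 : a ≠ 0 := norm_pos_iff.1 (lt_of_lt_of_le (by positivity) has)
  have hb0 : b ≠ 0 := norm_pos_iff.1 (lt_of_lt_of_le (by positivity) hbs)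
  set N := A / s with hN
  have hN1 : 1 ≤ N := (one_le_div hs).2 hsA
  set H := ‖h‖ with hHdef
  set d := ‖δ‖ with hd
  have hd0 : 0 ≤ d := norm_nonneg δ
  have hW : ‖w / b - 1 / (h + δ)‖ ≤ 4 * N * e / H := by
    refine (norm_div_sub_inv_le (A := 2 * A) hs hhδne hbs hbw).trans ?_
    calc 2 * A / s * e / ‖h + δ‖ ≤ 2 * A / s * e / (H / 2) := by gcongr
      _ = _ := by rw [hN]; ring
  have hP : ‖q / a‖ ≤ N * d / H :=
    (norm_div_le_of_le hs hH hq has).trans (le_of_eq (by rw [hN]; ring))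
  have hδh : ‖δ / h‖ = d / H := norm_div _ _
  have hPd : ‖q / a - δ / h‖ ≤ 3 * N * e * d / H := by
    rw [show q / a - δ / h = (q - δ * w) / a + δ * (w / a - 1 / h) by field_simp; ring]
    refine (norm_add_le _ _).trans ?_
    have h₁ := norm_div_le_of_le hs hH hqw has
    have h₂ := norm_div_sub_inv_le hs hh has haw
    rw [norm_mul]
    calc _ ≤ 2 * A * e * d / s / H + d * (A / s * e / H) := by gcongr
      _ = _ := by rw [hN]; ring
  have hwa : ‖w / a‖ ≤ N / H := norm_div_le_of_le hs hH hw has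
  have hqa : ‖(q - δ * v) / a‖ ≤ N * f * d / H :=
    (norm_div_le_of_le hs hH hqv has).trans (le_of_eq (by rw [hN]; ring))
  have hsum : ‖q / a + δ / h‖ ≤ 2 * N * d / H := by
    refine (norm_add_le _ _).trans ?_
    rw [hδh]
    calc ‖q / a‖ + d / H ≤ N * d / H + d / H := by gcongr
      _ ≤ N * d / H + N * d / H := by
          gcongr; exact le_mul_of_one_le_left hd0 hN1
      _ = _ := by ring
  have hinv : ‖1 / (h + δ)‖ ≤ 2 / H := by
    rw [norm_div, norm_one, div_le_div_iff₀ hhδ0 hH]; linarith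
  have key : (w / b - 1 / (h + δ)) - (w / a - 1 / h) - δ * (-(w * v) / a ^ 2 + 1 / h ^ 2) =
      (q / a) ^ 2 * (w / b - 1 / (h + δ)) +
        (q / a - δ / h) * (q / a + δ / h) * (1 / (h + δ)) - w / a * ((q - δ * v) / a) := by
    have : q = b - a := by rw [hb]; ring
    rw [this]
    field_simp
    ring
  rw [key]
  refine (norm_sub_le _ _).trans ((add_le_add_left (norm_add_le _ _) _).trans ?_)
  rw [norm_mul, norm_mul, norm_mul, norm_mul, norm_pow]
  calc _ ≤ (N * d / H) ^ 2 * (4 * N * e / H) +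
        (3 * N * e * d / H) * (2 * N * d / H) * (2 / H) + N / H * (N * f * d / H) := by gcongr
    _ = (4 * N ^ 3 + 12 * N ^ 2) * (d / H ^ 3) * (e * d) + N ^ 2 * (f * d / H ^ 2) := by
        field_simp; ring
    -- The quadratic terms carry |h|^γ |δ|² / |h|³; `hef` trades one factor to reach the form of the
    -- linear error.
    _ ≤ (4 * N ^ 3 + 12 * N ^ 2) * (d / H ^ 3) * (f * H) + N ^ 2 * (f * d / H ^ 2) := by gcongr
    _ = (4 * N ^ 3 + 13 * N ^ 2) * (f * d / H ^ 2) := by field_simp; ring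
    _ ≤ 17 * N ^ 3 * (f * d / H ^ 2) := by
        gcongr
        nlinarith [pow_le_pow_right₀ hN1 (show 2 ≤ 3 by norm_num)]

/-- Compare the product (w/a)(v/a) with (1/h)(1/h) one factor at a time. -/
theorem cauchy_deriv_le {a w v h : ℂ} {A s e : ℝ} (hs : 0 < s) (hsA : s ≤ A)
    (hh : h ≠ 0) (hv : ‖v‖ ≤ A) (has : s * ‖h‖ ≤ ‖a‖)
    (haw : ‖a - h * w‖ ≤ A * e * ‖h‖) (hav : ‖a - h * v‖ ≤ A * e * ‖h‖) :
    ‖-(w * v) / a ^ 2 + 1 / h ^ 2‖ ≤ 2 * (A / s) ^ 2 * (e / ‖h‖ ^ 2) := by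
  have hH : 0 < ‖h‖ := norm_pos_iff.2 hh
  have ha0 : a ≠ 0 := norm_pos_iff.1 (lt_of_lt_of_le (by positivity) has)
  have hA : 0 < A := by linarith
  have hN1 : 1 ≤ A / s := (one_le_div hs).2 hsA
  have he : 0 ≤ e := by
    have h0 := (norm_nonneg _).trans haw
    by_contra hneg
    have : A * e * ‖h‖ < 0 := mul_neg_of_neg_of_pos (mul_neg_of_pos_of_neg hA (not_le.1 hneg)) hH
    linarith
  rw [show -(w * v) / a ^ 2 + 1 / h ^ 2 =
    -((w / a - 1 / h) * (v / a)) - (v / a - 1 / h) * (1 / h) by field_simp; ring]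
  refine (norm_sub_le _ _).trans ?_
  have h₁ := norm_div_sub_inv_le hs hh has haw
  have h₂ := norm_div_sub_inv_le hs hh has hav
  have h₃ := norm_div_le_of_le hs hH hv has
  rw [norm_neg, norm_mul, norm_mul, norm_div 1 h, norm_one]
  calc _ ≤ (A / s * e / ‖h‖) * (A / s / ‖h‖) + (A / s * e / ‖h‖) * (1 / ‖h‖) := by gcongr
    _ ≤ (A / s * e / ‖h‖) * (A / s / ‖h‖) + (A / s * e / ‖h‖) * (A / s / ‖h‖) := by gcongr
    _ = _ := by field_simp; ring

/-- The alternating form `z w̄ - w z̄`. -/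
def altForm (w z : ℂ) : ℂ := z * conj w - w * conj z

/-- The form vanishes on real-parallel vectors, so a real multiple of one argument may be subtracted
from the other. This is the source of the extra Hölder smallness in the tensor kernel. -/
theorem norm_altForm_le (w z : ℂ) (c : ℝ) : ‖altForm w z‖ ≤ 2 * ‖w‖ * ‖z - c * w‖ := by
  have : altForm w z = (z - c * w) * conj w - w * conj (z - c * w) := by
    simp only [altForm, map_sub, map_mul, Complex.conj_ofReal]; ring
  rw [this]
  refine (norm_sub_le _ _).trans ?_
  rw [norm_mul, norm_mul, Complex.norm_conj, Complex.norm_conj]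
  exact le_of_eq (by ring)

theorem norm_altForm_le' (w z : ℂ) (c : ℝ) : ‖altForm w z‖ ≤ 2 * ‖z‖ * ‖w - c * z‖ := by
  have : altForm w z = z * conj (w - c * z) - (w - c * z) * conj z := by
    simp only [altForm, map_sub, map_mul, Complex.conj_ofReal]; ring
  rw [this]
  refine (norm_sub_le _ _).trans ?_
  rw [norm_mul, norm_mul, Complex.norm_conj, Complex.norm_conj]
  exact le_of_eq (by ring)

/-- Take c = 1/h. Keeping ‖a‖ on the right cancels one denominator exactly, without spending a
factor A/s. -/
theorem norm_altForm_secant_le {a w : ℂ} {h A e : ℝ} (hh : h ≠ 0)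
    (haw : ‖a - h * w‖ ≤ A * e * |h|) : ‖altForm w a‖ ≤ 2 * ‖a‖ * (A * e) := by
  have hH : 0 < |h| := abs_pos.2 hh
  have hhc : (h : ℂ) ≠ 0 := Complex.ofReal_ne_zero.2 hh
  refine (norm_altForm_le' w a h⁻¹).trans ?_
  gcongr
  rw [show w - ((h⁻¹ : ℝ) : ℂ) * a = -((a - h * w) / h) by push_cast; field_simp; ring, norm_neg,
    norm_div, Complex.norm_real, Real.norm_eq_abs, div_le_iff₀ hH]
  exact haw

/-- Expand the numerator linearly in `q` and the inverse square of the conjugate to first order.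
What remains is either of second order in `q`, with smallness from the alternating form, or linear
in q - δ v. -/
theorem tensor_taylor {a b q w v : ℂ} {h δ A s e f : ℝ} (hs : 0 < s) (hsA : s ≤ A)
    (he : 0 ≤ e) (hf : 0 ≤ f) (hb : b = a + q) (hh : h ≠ 0)
    (hw : ‖w‖ ≤ A) (has : s * |h| ≤ ‖a‖) (hbs : s * (|h| / 2) ≤ ‖b‖)
    (haw : ‖a - h * w‖ ≤ A * e * |h|)
    (hqw : ‖q - δ * w‖ ≤ 2 * A * e * |δ|) (hqv : ‖q - δ * v‖ ≤ A * f * |δ|)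
    (hq : ‖q‖ ≤ A * |δ|) (hef : e * |δ| ≤ f * |h|) :
    ‖altForm w b / conj b ^ 2 - altForm w a / conj a ^ 2 -
        δ * (altForm w v / conj a ^ 2 - 2 * altForm w a * conj v / conj a ^ 3)‖ ≤
      60 * (A / s) ^ 3 * (f * |δ| / |h| ^ 2) := by
  have hH : 0 < |h| := abs_pos.2 hh
  have hA : 0 < A := by linarith
  have hna : 0 < ‖a‖ := lt_of_lt_of_le (by positivity) has
  have hnb : 0 < ‖b‖ := lt_of_lt_of_le (by positivity) hbs
  have ha0 : a ≠ 0 := norm_pos_iff.1 hna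
  have hb0 : b ≠ 0 := norm_pos_iff.1 hnb
  have hca : conj a ≠ 0 := (map_ne_zero _).2 ha0
  have hcb : conj b ≠ 0 := (map_ne_zero _).2 hb0
  set N := A / s with hN
  have hN1 : 1 ≤ N := (one_le_div hs).2 hsA
  have hN0 : 0 ≤ N := by linarith
  set H := |h| with hHdef
  set d := |δ| with hd
  have hd0 : 0 ≤ d := abs_nonneg δ
  have hadd : ∀ x y : ℂ, altForm w (x + y) = altForm w x + altForm w y := fun x y => by
    simp only [altForm, map_add]; ring
  have hsub : altForm w (q - δ * v) = altForm w q - δ * altForm w v := by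
    simp only [altForm, map_sub, map_mul, Complex.conj_ofReal]; ring
  have la := norm_altForm_secant_le hh haw
  have lq : ‖altForm w q‖ ≤ 2 * A * (2 * A * e * d) :=
    (norm_altForm_le w q δ).trans (by gcongr)
  have lqv : ‖altForm w (q - δ * v)‖ ≤ 2 * A * (A * f * d) := by
    refine (norm_altForm_le w _ 0).trans ?_
    rw [Complex.ofReal_zero, zero_mul, sub_zero]
    gcongr
  have key : altForm w b / conj b ^ 2 - altForm w a / conj a ^ 2 -
        δ * (altForm w v / conj a ^ 2 - 2 * altForm w a * conj v / conj a ^ 3) =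
      altForm w a / conj a * (conj q / conj a) * (conj q / conj b) * (1 / conj b) +
      2 * (altForm w a / conj a) * (conj q / conj a) * (conj q / conj b) * (1 / conj a) -
      altForm w q * (conj q / conj b) * (1 / conj a) * (1 / conj b + 1 / conj a) +
      altForm w (q - δ * v) * (1 / conj a) ^ 2 -
      2 * (altForm w a / conj a) * (conj (q - δ * v) / conj a) * (1 / conj a) := by
    have hq' : conj q = conj b - conj a := by rw [hb, map_add]; ring
    have hlb : altForm w b = altForm w a + altForm w q := by rw [hb, hadd]
    rw [hsub, hlb, map_sub, map_mul, Complex.conj_ofReal, hq']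
    field_simp
    ring
  have nla : ‖altForm w a / conj a‖ ≤ 2 * A * e := by
    rw [norm_div, Complex.norm_conj, div_le_iff₀ hna]
    linarith
  have nqa : ‖conj q / conj a‖ ≤ N * d / H := by
    refine (norm_div_le_of_le (p := A * d) hs hH ?_ ?_).trans (le_of_eq (by rw [hN]; ring)) <;>
      rwa [Complex.norm_conj]
  have nqb : ‖conj q / conj b‖ ≤ 2 * N * d / H := by
    refine (norm_div_le_of_le (p := A * d) hs (half_pos hH) ?_ ?_).trans
      (le_of_eq (by rw [hN]; field_simp)) <;> rwa [Complex.norm_conj]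
  have nqv : ‖conj (q - δ * v) / conj a‖ ≤ N * f * d / H := by
    refine (norm_div_le_of_le (p := A * f * d) hs hH ?_ ?_).trans
      (le_of_eq (by rw [hN]; ring)) <;> rwa [Complex.norm_conj]
  have n1a : ‖1 / conj a‖ ≤ 1 / s / H :=
    norm_div_le_of_le hs hH (by rw [norm_one]) (by rwa [Complex.norm_conj])
  have n1b : ‖1 / conj b‖ ≤ 2 / s / H := by
    refine (norm_div_le_of_le (p := 1) hs (half_pos hH) (by rw [norm_one])
      (by rwa [Complex.norm_conj])).trans (le_of_eq (by field_simp))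
  have n1ab : ‖1 / conj b + 1 / conj a‖ ≤ 3 / s / H :=
    (norm_add_le _ _).trans ((add_le_add n1b n1a).trans (le_of_eq (by ring)))
  rw [key]
  have t₁ : ‖altForm w a / conj a * (conj q / conj a) * (conj q / conj b) * (1 / conj b)‖ ≤
      8 * N ^ 3 * (d / H ^ 3) * (e * d) := by
    rw [norm_mul, norm_mul, norm_mul]
    calc _ ≤ 2 * A * e * (N * d / H) * (2 * N * d / H) * (2 / s / H) := by gcongr
      _ = _ := by rw [hN]; field_simp; ring
  have t₂ : ‖2 * (altForm w a / conj a) * (conj q / conj a) * (conj q / conj b) *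
      (1 / conj a)‖ ≤ 8 * N ^ 3 * (d / H ^ 3) * (e * d) := by
    rw [norm_mul, norm_mul, norm_mul, norm_mul, Complex.norm_two]
    calc _ ≤ 2 * (2 * A * e) * (N * d / H) * (2 * N * d / H) * (1 / s / H) := by gcongr
      _ = _ := by rw [hN]; field_simp; ring
  have t₃ : ‖altForm w q * (conj q / conj b) * (1 / conj a) * (1 / conj b + 1 / conj a)‖ ≤
      24 * N ^ 3 * (d / H ^ 3) * (e * d) := by
    rw [norm_mul, norm_mul, norm_mul]
    calc _ ≤ 2 * A * (2 * A * e * d) * (2 * N * d / H) * (1 / s / H) * (3 / s / H) := by gcongr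
      _ = _ := by rw [hN]; field_simp; ring
  have t₄ : ‖altForm w (q - δ * v) * (1 / conj a) ^ 2‖ ≤ 2 * N ^ 2 * (f * d / H ^ 2) := by
    rw [norm_mul, norm_pow]
    calc _ ≤ 2 * A * (A * f * d) * (1 / s / H) ^ 2 := by gcongr
      _ = _ := by rw [hN]; field_simp
  -- In the last term q - δ v already supplies the Hölder factor, so a bound without `e` is enough.
  have nla' : ‖altForm w a / conj a‖ ≤ 2 * A := by
    rw [norm_div, Complex.norm_conj, div_le_iff₀ hna]
    have := norm_altForm_le' w a 0
    rw [Complex.ofReal_zero, zero_mul, sub_zero] at this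
    calc _ ≤ 2 * ‖a‖ * ‖w‖ := this
      _ ≤ 2 * ‖a‖ * A := by gcongr
      _ = _ := by ring
  have t₅ : ‖2 * (altForm w a / conj a) * (conj (q - δ * v) / conj a) * (1 / conj a)‖ ≤
      4 * N ^ 2 * (f * d / H ^ 2) := by
    rw [norm_mul, norm_mul, norm_mul, Complex.norm_two]
    calc _ ≤ 2 * (2 * A) * (N * f * d / H) * (1 / s / H) := by gcongr
      _ = _ := by rw [hN]; field_simp; ring
  refine (norm_sub_le_of_le (norm_add_le_of_le (norm_sub_le_of_le (norm_add_le_of_le t₁ t₂) t₃) t₄)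
    t₅).trans ?_
  calc _ = 40 * N ^ 3 * (d / H ^ 3) * (e * d) + 6 * N ^ 2 * (f * d / H ^ 2) := by ring
    _ ≤ 40 * N ^ 3 * (d / H ^ 3) * (f * H) + 6 * N ^ 2 * (f * d / H ^ 2) := by gcongr
    _ = (40 * N ^ 3 + 6 * N ^ 2) * (f * d / H ^ 2) := by field_simp
    _ ≤ 60 * N ^ 3 * (f * d / H ^ 2) := by
        gcongr
        nlinarith [pow_le_pow_right₀ hN1 (show 2 ≤ 3 by norm_num), pow_nonneg hN0 3]

theorem tensor_deriv_le {a w v : ℂ} {h A s e : ℝ} (hs : 0 < s) (hsA : s ≤ A)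
    (hh : h ≠ 0) (hv : ‖v‖ ≤ A) (hw : ‖w‖ ≤ A) (hwv : ‖v - w‖ ≤ A * e) (has : s * |h| ≤ ‖a‖)
    (haw : ‖a - h * w‖ ≤ A * e * |h|) :
    ‖altForm w v / conj a ^ 2 - 2 * altForm w a * conj v / conj a ^ 3‖ ≤
      6 * (A / s) ^ 2 * (e / |h| ^ 2) := by
  have hH : 0 < |h| := abs_pos.2 hh
  have hna : 0 < ‖a‖ := lt_of_lt_of_le (by positivity) has
  have hca : conj a ≠ 0 := (map_ne_zero _).2 (norm_pos_iff.1 hna)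
  have hA : 0 < A := by linarith
  have he : 0 ≤ A * e := (norm_nonneg _).trans hwv
  have la := norm_altForm_secant_le hh haw
  have lv : ‖altForm w v‖ ≤ 2 * A * (A * e) := by
    refine (norm_altForm_le w v 1).trans ?_
    rw [Complex.ofReal_one, one_mul]
    gcongr
  have nla : ‖altForm w a / conj a‖ ≤ 2 * (A * e) := by
    rw [norm_div, Complex.norm_conj, div_le_iff₀ hna]
    linarith
  have n1a : ‖1 / conj a‖ ≤ 1 / s / |h| :=
    norm_div_le_of_le hs hH (by rw [norm_one]) (by rwa [Complex.norm_conj])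
  rw [show altForm w v / conj a ^ 2 - 2 * altForm w a * conj v / conj a ^ 3 =
    altForm w v * (1 / conj a) ^ 2 - 2 * (altForm w a / conj a) * conj v * (1 / conj a) ^ 2 by
      field_simp]
  refine (norm_sub_le _ _).trans ?_
  rw [norm_mul, norm_mul, norm_mul, norm_mul, norm_pow, Complex.norm_conj, Complex.norm_two]
  calc _ ≤ 2 * A * (A * e) * (1 / s / |h|) ^ 2 +
        2 * (2 * (A * e)) * A * (1 / s / |h|) ^ 2 := by gcongr
    _ = _ := by field_simp; ring

end

section

/-! ### Kernels attached to a curve -/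

/-- A `C^{1,γ}` curve in the complex plane which satisfies an arc-chord condition at distances at
most `3π/2`. -/
structure ArcChord (γ A s : ℝ) (Z Z' : ℝ → ℂ) : Prop where
  pos : 0 < s
  hasDerivAt : ∀ t, HasDerivAt Z (Z' t) t
  continuous_deriv : Continuous Z'
  bound : ∀ t, ‖Z' t‖ ≤ A
  holder : ∀ a b, ‖Z' a - Z' b‖ ≤ A * |a - b| ^ γ
  lower : ∀ a b, |a - b| ≤ 3 * π / 2 → s * |a - b| ≤ ‖Z a - Z b‖

/-- The Cauchy kernel of a curve with the singularity on the diagonal removed. -/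
noncomputable def cauchyKernel (Z Z' : ℝ → ℂ) (θ t : ℝ) : ℂ :=
  Z' t / (Z θ - Z t) - 1 / ((θ - t : ℝ) : ℂ)

/-- The derivative of `cauchyKernel` in its first variable. -/
noncomputable def cauchyKernelDeriv (Z Z' : ℝ → ℂ) (θ t : ℝ) : ℂ :=
  -(Z' t * Z' θ) / (Z θ - Z t) ^ 2 + 1 / ((θ - t : ℝ) : ℂ) ^ 2

/-- The derivative in `t` of `(Z θ - Z t) / conj (Z θ - Z t)`. -/
noncomputable def tensorKernel (Z Z' : ℝ → ℂ) (θ t : ℝ) : ℂ :=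
  altForm (Z' t) (Z θ - Z t) / conj (Z θ - Z t) ^ 2

/-- The derivative of `tensorKernel` in its first variable. -/
noncomputable def tensorKernelDeriv (Z Z' : ℝ → ℂ) (θ t : ℝ) : ℂ :=
  altForm (Z' t) (Z' θ) / conj (Z θ - Z t) ^ 2 -
    2 * altForm (Z' t) (Z θ - Z t) * conj (Z' θ) / conj (Z θ - Z t) ^ 3

variable {γ A s : ℝ} {Z Z' : ℝ → ℂ}

/-! ### Secants, tangents and the kernel estimates -/

theorem ArcChord.nonneg (hZ : ArcChord γ A s Z Z') : 0 ≤ A := (norm_nonneg _).trans (hZ.bound 0)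

theorem ArcChord.norm_sub_le (hZ : ArcChord γ A s Z Z') (a b : ℝ) :
    ‖Z a - Z b‖ ≤ A * |a - b| :=
  convex_univ.norm_image_sub_le_of_norm_hasDerivWithin_le
    (fun x _ => (hZ.hasDerivAt x).hasDerivWithinAt) (fun x _ => hZ.bound x) (mem_univ b)
    (mem_univ a)

theorem ArcChord.le (hZ : ArcChord γ A s Z Z') : s ≤ A := by
  have h₁ := hZ.lower 1 0 (by rw [sub_zero, abs_one]; linarith [Real.pi_gt_three])
  have h₂ := hZ.norm_sub_le 1 0
  rw [sub_zero, abs_one, mul_one] at h₁ h₂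
  exact h₁.trans h₂

theorem ArcChord.continuous (hZ : ArcChord γ A s Z Z') : Continuous Z :=
  continuous_iff_continuousAt.2 fun t => (hZ.hasDerivAt t).continuousAt

/-- Mean value inequality for t ↦ Z(t) - t Z'(c) on the interval of radius r about c. The base point
of the tangent need not be an endpoint of the secant. -/
theorem ArcChord.norm_sub_sub_le (hγ : 0 < γ) (hZ : ArcChord γ A s Z Z') {a b c r : ℝ}
    (ha : |a - c| ≤ r) (hb : |b - c| ≤ r) :
    ‖Z b - Z a - ((b - a : ℝ) : ℂ) * Z' c‖ ≤ A * r ^ γ * |b - a| := by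
  have hA := hZ.nonneg
  have h := (convex_Icc (c - r) (c + r)).norm_image_sub_le_of_norm_hasDerivWithin_le
    (f := fun t => Z t - (t : ℂ) * Z' c) (f' := fun t => Z' t - 1 * Z' c) (C := A * r ^ γ)
    (x := a) (y := b)
    (fun x _ => ((hZ.hasDerivAt x).sub
      ((Complex.ofRealCLM.hasDerivAt (x := x)).mul_const (Z' c))).hasDerivWithinAt)
    (fun x hx => by
      rw [one_mul]
      refine (hZ.holder x c).trans ?_
      have : |x - c| ≤ r := by rw [abs_le]; constructor <;> linarith [hx.1, hx.2]
      gcongr)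
    (by rw [abs_le] at ha; constructor <;> linarith [ha.1, ha.2])
    (by rw [abs_le] at hb; constructor <;> linarith [hb.1, hb.2])
  refine le_trans (le_of_eq ?_) h
  congr 1
  push_cast
  ring

theorem two_mul_rpow_le (hγ : γ < 1) {x : ℝ} (hx : 0 ≤ x) : (2 * x) ^ γ ≤ 2 * x ^ γ := by
  rw [Real.mul_rpow two_pos.le hx]
  gcongr
  calc (2 : ℝ) ^ γ ≤ 2 ^ (1 : ℝ) := Real.rpow_le_rpow_of_exponent_le one_le_two hγ.le
    _ = 2 := Real.rpow_one 2

/-- Divide by x^γ y^γ and use monotonicity of the power 1 - γ. With x = |η - θ| and y = |θ - t| it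
supplies the hypothesis `hef` of the algebraic estimates. -/
theorem rpow_mul_le_rpow_mul (hγ : γ < 1) {x y : ℝ} (hx : 0 < x) (hxy : x ≤ y) :
    y ^ γ * x ≤ x ^ γ * y := by
  have hy : 0 < y := hx.trans_le hxy
  have h : x ^ (1 - γ) ≤ y ^ (1 - γ) := Real.rpow_le_rpow hx.le hxy (by linarith)
  have ex : x = x ^ γ * x ^ (1 - γ) := by rw [← Real.rpow_add hx]; simp
  have ey : y = y ^ γ * y ^ (1 - γ) := by rw [← Real.rpow_add hy]; simp
  calc y ^ γ * x = y ^ γ * x ^ γ * x ^ (1 - γ) := by rw [mul_assoc, ← ex]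
    _ ≤ y ^ γ * x ^ γ * y ^ (1 - γ) := by gcongr
    _ = x ^ γ * (y ^ γ * y ^ (1 - γ)) := by ring
    _ = x ^ γ * y := by rw [← ey]

/-- The estimates for three points `θ`, `η`, `t` with `η` closer to `θ` than `t`. -/
theorem ArcChord.three_points (hγ : 0 < γ) (hγ1 : γ < 1) (hZ : ArcChord γ A s Z Z') {θ η t : ℝ}
    (hne : θ ≠ η) (hd : 2 * |η - θ| ≤ |θ - t|) :
    ‖(Z η - Z t) - ((θ - t : ℝ) + (η - θ : ℝ) : ℂ) * Z' t‖ ≤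
        2 * A * |θ - t| ^ γ * ‖((θ - t : ℝ) + (η - θ : ℝ) : ℂ)‖ ∧
      ‖(Z η - Z θ) - ((η - θ : ℝ) : ℂ) * Z' t‖ ≤ 2 * A * |θ - t| ^ γ * |η - θ| ∧
      ‖(Z η - Z θ) - ((η - θ : ℝ) : ℂ) * Z' θ‖ ≤ A * |η - θ| ^ γ * |η - θ| ∧
      |θ - t| ^ γ * |η - θ| ≤ |η - θ| ^ γ * |θ - t| := by
  have hA := hZ.nonneg
  have hδ : 0 < |η - θ| := abs_pos.2 (sub_ne_zero.2 hne.symm)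
  have hη : |η - t| ≤ 2 * |θ - t| := by
    calc |η - t| ≤ |η - θ| + |θ - t| := abs_sub_le _ _ _
      _ ≤ _ := by linarith
  have h2 := two_mul_rpow_le hγ1 (abs_nonneg (θ - t))
  refine ⟨?_, ?_, ?_, rpow_mul_le_rpow_mul hγ1 hδ (by linarith)⟩
  · have h := hZ.norm_sub_sub_le hγ (a := t) (b := η) (c := t) (by simp) hη
    have e : ((θ - t : ℝ) + (η - θ : ℝ) : ℂ) = ((η - t : ℝ) : ℂ) := by push_cast; ring
    rw [e, Complex.norm_real, Real.norm_eq_abs]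
    refine h.trans ?_
    calc A * (2 * |θ - t|) ^ γ * |η - t| ≤ A * (2 * |θ - t| ^ γ) * |η - t| := by gcongr
      _ = _ := by ring
  · have h := hZ.norm_sub_sub_le hγ (a := θ) (b := η) (c := t) (r := 2 * |θ - t|)
      (by linarith [abs_nonneg (θ - t)]) hη
    refine h.trans ?_
    calc A * (2 * |θ - t|) ^ γ * |η - θ| ≤ A * (2 * |θ - t| ^ γ) * |η - θ| := by gcongr
      _ = _ := by ring
  · exact hZ.norm_sub_sub_le hγ (a := θ) (b := η) (c := θ) (by simp) le_rfl

theorem rpow_mul_div_sq {x y : ℝ} (hx : 0 < x) (hy : 0 < y) :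
    x ^ γ * x / y ^ 2 = x ^ (1 + γ) * y ^ (-2 : ℝ) := by
  rw [add_comm, Real.rpow_add hx, Real.rpow_one, Real.rpow_neg hy.le, Real.rpow_two, div_eq_mul_inv]

theorem rpow_div_sq {y : ℝ} (hy : 0 < y) : y ^ γ / y ^ 2 = y ^ (γ - 2) := by
  rw [Real.rpow_sub hy, Real.rpow_two]

/-- A smaller constant would do; 60 is shared with `ArcChord.tensor`. Lower powers of A/s are
absorbed into the cube since A/s ≥ 1. -/
theorem ArcChord.cauchy (hγ : 0 < γ) (hγ1 : γ < 1) (hZ : ArcChord γ A s Z Z') :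
    SingularKernel γ (60 * (A / s) ^ 3) (cauchyKernel Z Z') (cauchyKernelDeriv Z Z') := by
  have hs := hZ.pos
  have hA := hZ.nonneg
  have hN1 : 1 ≤ A / s := (one_le_div hs).2 hZ.le
  have hN2 : (A / s) ^ 2 ≤ (A / s) ^ 3 := pow_le_pow_right₀ hN1 (by norm_num)
  have hN3 : A / s ≤ (A / s) ^ 3 := le_self_pow₀ hN1 (by norm_num)
  have hN0 : 0 ≤ (A / s) ^ 3 := by positivity
  have hπ := Real.pi_pos
  have mZ := hZ.continuous.measurable
  have mZ' := hZ.continuous_deriv.measurable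
  have haw : ∀ θ t : ℝ, ‖(Z θ - Z t) - ((θ - t : ℝ) : ℂ) * Z' t‖ ≤
      A * |θ - t| ^ γ * ‖((θ - t : ℝ) : ℂ)‖ := fun θ t => by
    rw [Complex.norm_real, Real.norm_eq_abs]
    exact hZ.norm_sub_sub_le hγ (a := t) (b := θ) (c := t) (by simp) le_rfl
  have hav : ∀ θ t : ℝ, ‖(Z θ - Z t) - ((θ - t : ℝ) : ℂ) * Z' θ‖ ≤
      A * |θ - t| ^ γ * ‖((θ - t : ℝ) : ℂ)‖ := fun θ t => by
    rw [Complex.norm_real, Real.norm_eq_abs]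
    exact hZ.norm_sub_sub_le hγ (a := t) (b := θ) (c := θ) (by rw [abs_sub_comm]) (by simp)
  have hlow : ∀ θ t : ℝ, |θ - t| ≤ 3 * π / 2 → s * ‖((θ - t : ℝ) : ℂ)‖ ≤ ‖Z θ - Z t‖ :=
    fun θ t h => by rw [Complex.norm_real, Real.norm_eq_abs]; exact hZ.lower θ t h
  refine ⟨fun θ => ?_, fun θ => ?_, fun θ t hne h => ?_, fun θ t hne h => ?_,
    fun θ η t hne hd h => ?_⟩
  · unfold cauchyKernel; fun_prop
  · unfold cauchyKernelDeriv; fun_prop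
  · have hh : ((θ - t : ℝ) : ℂ) ≠ 0 := Complex.ofReal_ne_zero.2 (sub_ne_zero.2 hne)
    have hH : 0 < |θ - t| := abs_pos.2 (sub_ne_zero.2 hne)
    refine (norm_div_sub_inv_le hs hh (hlow θ t h) (haw θ t)).trans ?_
    rw [Complex.norm_real, Real.norm_eq_abs, mul_div_assoc, Real.rpow_sub_one hH.ne']
    gcongr
    linarith
  · have hh : ((θ - t : ℝ) : ℂ) ≠ 0 := Complex.ofReal_ne_zero.2 (sub_ne_zero.2 hne)
    have hH : 0 < |θ - t| := abs_pos.2 (sub_ne_zero.2 hne)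
    refine (cauchy_deriv_le hs hZ.le hh (hZ.bound θ) (hlow θ t (by linarith))
      (haw θ t) (hav θ t)).trans ?_
    rw [Complex.norm_real, Real.norm_eq_abs, rpow_div_sq hH]
    gcongr
    linarith
  · have hδ : 0 < |η - θ| := abs_pos.2 (sub_ne_zero.2 hne.symm)
    have hH : 0 < |θ - t| := by linarith
    have hh : ((θ - t : ℝ) : ℂ) ≠ 0 := Complex.ofReal_ne_zero.2 (abs_pos.1 hH)
    obtain ⟨hbw, hqw, hqv, hef⟩ := hZ.three_points hγ hγ1 hne hd
    have hη : |η - t| ≤ 3 * π / 2 := by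
      calc |η - t| ≤ |η - θ| + |θ - t| := abs_sub_le _ _ _
        _ ≤ _ := by linarith
    have e : ((θ - t : ℝ) + (η - θ : ℝ) : ℂ) = ((η - t : ℝ) : ℂ) := by push_cast; ring
    have n₁ : ‖((η - θ : ℝ) : ℂ)‖ = |η - θ| := by rw [Complex.norm_real, Real.norm_eq_abs]
    have n₂ : ‖((θ - t : ℝ) : ℂ)‖ = |θ - t| := by rw [Complex.norm_real, Real.norm_eq_abs]
    have key := cauchy_taylor (a := Z θ - Z t) (b := Z η - Z t) (q := Z η - Z θ) (w := Z' t)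
      (v := Z' θ) (h := ((θ - t : ℝ) : ℂ)) (δ := ((η - θ : ℝ) : ℂ)) (A := A) (s := s)
      (e := |θ - t| ^ γ) (f := |η - θ| ^ γ) hs hZ.le (by positivity) (by positivity)
      (by ring) hh (by rw [n₁, n₂]; exact hd) (hZ.bound t) (hlow θ t (by linarith))
      (by rw [e]; exact hlow η t hη) (haw θ t) hbw
      (by rw [n₁]; exact hqw) (by rw [n₁]; exact hqv)
      (by rw [n₁]; exact hZ.norm_sub_le η θ) (by rw [n₁, n₂]; exact hef)
    rw [n₁, n₂, rpow_mul_div_sq hδ hH, e] at key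
    refine key.trans ?_
    gcongr
    linarith

theorem ArcChord.tensor (hγ : 0 < γ) (hγ1 : γ < 1) (hZ : ArcChord γ A s Z Z') :
    SingularKernel γ (60 * (A / s) ^ 3) (tensorKernel Z Z') (tensorKernelDeriv Z Z') := by
  have hs := hZ.pos
  have hA := hZ.nonneg
  have hN1 : 1 ≤ A / s := (one_le_div hs).2 hZ.le
  have hN2 : (A / s) ^ 2 ≤ (A / s) ^ 3 := pow_le_pow_right₀ hN1 (by norm_num)
  have hN3 : A / s ≤ (A / s) ^ 3 := le_self_pow₀ hN1 (by norm_num)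
  have hN0 : 0 ≤ (A / s) ^ 3 := by positivity
  have hπ := Real.pi_pos
  have mZ := hZ.continuous.measurable
  have mZ' := hZ.continuous_deriv.measurable
  have haw : ∀ θ t : ℝ, ‖(Z θ - Z t) - ((θ - t : ℝ) : ℂ) * Z' t‖ ≤
      A * |θ - t| ^ γ * |θ - t| := fun θ t =>
    hZ.norm_sub_sub_le hγ (a := t) (b := θ) (c := t) (by simp) le_rfl
  have mc : Measurable (conj : ℂ → ℂ) := Complex.continuous_conj.measurable
  refine ⟨fun θ => ?_, fun θ => ?_, fun θ t hne h => ?_, fun θ t hne h => ?_,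
    fun θ η t hne hd h => ?_⟩
  · unfold tensorKernel altForm; fun_prop
  · unfold tensorKernelDeriv altForm; fun_prop
  · have hH : 0 < |θ - t| := abs_pos.2 (sub_ne_zero.2 hne)
    have hlow := hZ.lower θ t h
    have hna : 0 < ‖Z θ - Z t‖ := lt_of_lt_of_le (by positivity) hlow
    have la := norm_altForm_secant_le (sub_ne_zero.2 hne) (haw θ t)
    unfold tensorKernel
    rw [norm_div, norm_pow, Complex.norm_conj]
    calc _ ≤ 2 * ‖Z θ - Z t‖ * (A * |θ - t| ^ γ) / ‖Z θ - Z t‖ ^ 2 := by gcongr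
      _ = 2 * (A * |θ - t| ^ γ) / ‖Z θ - Z t‖ := by field_simp
      _ ≤ 2 * (A * |θ - t| ^ γ) / (s * |θ - t|) := by gcongr
      _ = 2 * (A / s) * |θ - t| ^ (γ - 1) := by
        rw [Real.rpow_sub_one hH.ne']; field_simp
      _ ≤ _ := by
        gcongr
        linarith
  · have hH : 0 < |θ - t| := abs_pos.2 (sub_ne_zero.2 hne)
    refine (tensor_deriv_le hs hZ.le (sub_ne_zero.2 hne) (hZ.bound θ) (hZ.bound t)
      (hZ.holder θ t) (hZ.lower θ t (by linarith)) (haw θ t)).trans ?_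
    rw [rpow_div_sq hH]
    gcongr
    linarith
  · have hδ : 0 < |η - θ| := abs_pos.2 (sub_ne_zero.2 hne.symm)
    have hH : 0 < |θ - t| := by linarith
    obtain ⟨-, hqw, hqv, hef⟩ := hZ.three_points hγ hγ1 hne hd
    have hη : |η - t| ≤ 3 * π / 2 := by
      calc |η - t| ≤ |η - θ| + |θ - t| := abs_sub_le _ _ _
        _ ≤ _ := by linarith
    have hη' : |θ - t| / 2 ≤ |η - t| := by
      have := abs_sub_le θ η t
      rw [abs_sub_comm θ η] at this
      linarith
    have key := tensor_taylor (a := Z θ - Z t) (b := Z η - Z t) (q := Z η - Z θ) (w := Z' t)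
      (v := Z' θ) (h := θ - t) (δ := η - θ) (A := A) (s := s)
      (e := |θ - t| ^ γ) (f := |η - θ| ^ γ) hs hZ.le (by positivity) (by positivity)
      (by ring) (abs_pos.1 hH) (hZ.bound t) (hZ.lower θ t (by linarith))
      ((mul_le_mul_of_nonneg_left hη' hs.le).trans (hZ.lower η t hη)) (haw θ t) hqw hqv
      (hZ.norm_sub_le η θ) hef
    rw [rpow_mul_div_sq hδ hH] at key
    exact key

/-! ### Real parts and differences of singular kernels -/

theorem SingularKernel.re {M : ℝ} {K K₁ : ℝ → ℝ → ℂ} (hK : SingularKernel γ M K K₁) :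
    SingularKernel γ M (fun θ t => ((K θ t).re : ℂ)) (fun θ t => ((K₁ θ t).re : ℂ)) where
  measurable θ := by have := hK.measurable θ; fun_prop
  measurable_deriv θ := by have := hK.measurable_deriv θ; fun_prop
  bound θ t h₁ h₂ := by
    rw [Complex.norm_real]
    exact (Complex.abs_re_le_norm _).trans (hK.bound θ t h₁ h₂)
  bound_deriv θ t h₁ h₂ := by
    rw [Complex.norm_real]
    exact (Complex.abs_re_le_norm _).trans (hK.bound_deriv θ t h₁ h₂)
  taylor θ η t h₁ h₂ h₃ := by
    have e : ((K η t).re : ℂ) - ((K θ t).re : ℂ) - ((η - θ : ℝ) : ℂ) * ((K₁ θ t).re : ℂ) =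
        ((K η t - K θ t - ((η - θ : ℝ) : ℂ) * K₁ θ t).re : ℂ) := by
      rw [Complex.sub_re, Complex.sub_re, Complex.re_ofReal_mul]; push_cast; ring
    rw [e, Complex.norm_real]
    exact (Complex.abs_re_le_norm _).trans (hK.taylor θ η t h₁ h₂ h₃)

theorem SingularKernel.sub {M M' : ℝ} {K K₁ L L₁ : ℝ → ℝ → ℂ} (hK : SingularKernel γ M K K₁)
    (hL : SingularKernel γ M' L L₁) :
    SingularKernel γ (M + M') (fun θ t => K θ t - L θ t) (fun θ t => K₁ θ t - L₁ θ t) where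
  measurable θ := (hK.measurable θ).sub (hL.measurable θ)
  measurable_deriv θ := (hK.measurable_deriv θ).sub (hL.measurable_deriv θ)
  bound θ t h₁ h₂ := by
    rw [add_mul]
    exact norm_sub_le_of_le (hK.bound θ t h₁ h₂) (hL.bound θ t h₁ h₂)
  bound_deriv θ t h₁ h₂ := by
    rw [add_mul]
    exact norm_sub_le_of_le (hK.bound_deriv θ t h₁ h₂) (hL.bound_deriv θ t h₁ h₂)
  taylor θ η t h₁ h₂ h₃ := by
    rw [add_mul]
    refine le_trans (le_of_eq ?_)
      (norm_sub_le_of_le (hK.taylor θ η t h₁ h₂ h₃) (hL.taylor θ η t h₁ h₂ h₃))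
    congr 1
    ring

/-! ### Kernels of mean zero -/

theorem ArcChord.continuous_dslope (hZ : ArcChord γ A s Z Z') (θ : ℝ) :
    Continuous (dslope Z θ) := by
  rw [continuous_iff_continuousAt]
  intro t
  rcases eq_or_ne t θ with rfl | h
  · exact continuousAt_dslope_same.2 (hZ.hasDerivAt t).differentiableAt
  · exact (continuousAt_dslope_of_ne h).2 hZ.continuous.continuousAt

/-- Off the diagonal the arc-chord bound gives the lower bound s, which passes to the limit at t =
θ. Hence quotients and logarithms of the slope are continuous across the diagonal. -/
theorem ArcChord.norm_dslope_pos (hZ : ArcChord γ A s Z Z') {θ t : ℝ} (h : |t - θ| ≤ π) :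
    0 < ‖dslope Z θ t‖ := by
  have hs := hZ.pos
  have hπ := Real.pi_pos
  have key : ∀ t : ℝ, t ≠ θ → |t - θ| ≤ π → s ≤ ‖dslope Z θ t‖ := by
    intro t hne h
    have hH : 0 < |t - θ| := abs_pos.2 (sub_ne_zero.2 hne)
    rw [dslope_of_ne _ hne, slope_def_module, norm_smul, norm_inv, Real.norm_eq_abs,
      inv_mul_eq_div, le_div_iff₀ hH]
    exact hZ.lower t θ (by linarith)
  rcases eq_or_ne t θ with rfl | hne
  · have hc : Filter.Tendsto (fun x => ‖dslope Z t x‖) (nhdsWithin t {t}ᶜ)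
        (nhds ‖dslope Z t t‖) :=
      ((hZ.continuous_dslope t).norm.tendsto t).mono_left nhdsWithin_le_nhds
    refine hs.trans_le (ge_of_tendsto hc ?_)
    filter_upwards [self_mem_nhdsWithin,
      mem_nhdsWithin_of_mem_nhds (Metric.closedBall_mem_nhds t hπ)] with x hx hx'
    exact key x hx hx'
  · exact hs.trans_le (key t hne h)

theorem ArcChord.hasDerivAt_ratio (hZ : ArcChord γ A s Z Z') {θ t : ℝ} (h : Z θ - Z t ≠ 0) :
    HasDerivAt (fun t => (Z θ - Z t) / conj (Z θ - Z t)) (tensorKernel Z Z' θ t) t := by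
  have h₁ : HasDerivAt (fun t => Z θ - Z t) (-Z' t) t := (hZ.hasDerivAt t).const_sub (Z θ)
  have h₂ : HasDerivAt (fun t => conj (Z θ - Z t)) (conj (-Z' t)) t := h₁.star
  refine (h₁.div h₂ ((map_ne_zero _).2 h)).congr_deriv ?_
  simp only [tensorKernel, altForm, map_neg]
  congr 1
  ring

end

section

variable {γ A s : ℝ} {Z Z' : ℝ → ℂ}

/-- The primitive z/z̄ is unchanged when z is divided by the real number t - θ, so it extends
continuously across t = θ through the slope. The fundamental theorem off one point applies, and
periodicity of Z makes the endpoint values equal. -/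
theorem ArcChord.integral_tensorKernel (hγ : 0 < γ) (hγ1 : γ < 1) (hZ : ArcChord γ A s Z Z')
    (hper : Function.Periodic Z (2 * π)) (θ : ℝ) :
    ∫ t in (θ - π)..(θ + π), tensorKernel Z Z' θ t = 0 := by
  have hπ := Real.pi_pos
  have hD : ∀ t, t ≠ θ → dslope Z θ t / conj (dslope Z θ t) =
      (Z θ - Z t) / conj (Z θ - Z t) := by
    intro t ht
    have ht' : ((t : ℂ) - θ) ≠ 0 := by
      rw [← Complex.ofReal_sub]; exact Complex.ofReal_ne_zero.2 (sub_ne_zero.2 ht)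
    rw [dslope_of_ne _ ht, slope_def_module, Complex.real_smul, map_mul, Complex.conj_ofReal,
      mul_div_mul_left, ← neg_sub (Z θ) (Z t), map_neg, neg_div_neg_eq]
    push_cast
    exact inv_ne_zero ht'
  rw [integral_eq_of_hasDerivAt_off_countable_of_le
    (fun t => dslope Z θ t / conj (dslope Z θ t)) _ (by linarith) (countable_singleton θ) ?_ ?_
    ((hZ.tensor hγ hγ1).intervalIntegrable hγ θ)]
  · rw [hD _ (by linarith), hD _ (by linarith), ← hper (θ - π),
      show θ - π + 2 * π = θ + π by ring, sub_self]
  · intro t ht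
    have hpos := hZ.norm_dslope_pos (θ := θ) (t := t)
      (by rw [abs_le]; constructor <;> linarith [ht.1, ht.2])
    have hc := (hZ.continuous_dslope θ).continuousAt (x := t)
    exact (hc.div (Complex.continuous_conj.continuousAt.comp hc)
      ((map_ne_zero _).2 (norm_pos_iff.1 hpos))).continuousWithinAt
  · rintro t ⟨ht, hne⟩
    have hne : t ≠ θ := hne
    have hH : 0 < |θ - t| := abs_pos.2 (sub_ne_zero.2 hne.symm)
    have hs := hZ.pos
    have hz : Z θ - Z t ≠ 0 := norm_pos_iff.1 (lt_of_lt_of_le (by positivity)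
      (hZ.lower θ t (by rw [abs_le]; constructor <;> linarith [ht.1, ht.2])))
    refine (hZ.hasDerivAt_ratio hz).congr_of_eventuallyEq ?_
    filter_upwards [isOpen_ne.mem_nhds hne] with x hx using hD x hx

theorem re_div_eq_inner (z w : ℂ) : (w / z).re = inner ℝ z w / ‖z‖ ^ 2 := by
  rw [Complex.div_re, Complex.inner, ← Complex.normSq_eq_norm_sq, ← add_div]
  congr 1
  simp

theorem hasDerivAt_log_norm_sq {f : ℝ → ℂ} {f' : ℂ} {t : ℝ} (hf : HasDerivAt f f' t)
    (h : f t ≠ 0) : HasDerivAt (fun t => Real.log (‖f t‖ ^ 2) / 2) (f' / f t).re t := by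
  have hn : ‖f t‖ ^ 2 ≠ 0 := pow_ne_zero 2 (norm_ne_zero_iff.2 h)
  refine ((hf.norm_sq.log hn).div_const 2).congr_deriv ?_
  rw [re_div_eq_inner]
  ring

/-- A primitive is minus the logarithm of the modulus of the slope, continuous across the diagonal.
At the two endpoints |θ - t| = π and Z takes the same value, so the boundary terms cancel; this uses
that the period is centred at θ. -/
theorem ArcChord.integral_re_cauchyKernel (hγ : 0 < γ) (hγ1 : γ < 1) (hZ : ArcChord γ A s Z Z')
    (hper : Function.Periodic Z (2 * π)) (θ : ℝ) :
    ∫ t in (θ - π)..(θ + π), ((cauchyKernel Z Z' θ t).re : ℂ) = 0 := by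
  have hπ := Real.pi_pos
  set G : ℝ → ℝ := fun t => -(Real.log (‖dslope Z θ t‖ ^ 2) / 2) with hG
  have hD : ∀ t, t ≠ θ → Z θ - Z t ≠ 0 → G t =
      Real.log (‖((θ - t : ℝ) : ℂ)‖ ^ 2) / 2 - Real.log (‖Z θ - Z t‖ ^ 2) / 2 := by
    intro t ht hz
    have hn : ‖Z θ - Z t‖ ^ 2 ≠ 0 := pow_ne_zero 2 (norm_ne_zero_iff.2 hz)
    have hn' : ‖((θ - t : ℝ) : ℂ)‖ ^ 2 ≠ 0 :=
      pow_ne_zero 2 (norm_ne_zero_iff.2 (Complex.ofReal_ne_zero.2 (sub_ne_zero.2 ht.symm)))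
    have e : ‖dslope Z θ t‖ ^ 2 = ‖Z θ - Z t‖ ^ 2 / ‖((θ - t : ℝ) : ℂ)‖ ^ 2 := by
      rw [dslope_of_ne _ ht, slope_def_module, norm_smul, norm_inv, ← norm_sub_rev (Z θ),
        Complex.norm_real, norm_sub_rev θ t, mul_pow, inv_pow, inv_mul_eq_div]
    rw [hG]
    simp only [e]
    rw [Real.log_div hn hn']
    ring
  have hz : ∀ t, t ≠ θ → |θ - t| ≤ π → Z θ - Z t ≠ 0 := by
    intro t hne ht
    have hH : 0 < |θ - t| := abs_pos.2 (sub_ne_zero.2 hne.symm)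
    have hs := hZ.pos
    exact norm_pos_iff.1 (lt_of_lt_of_le (by positivity) (hZ.lower θ t (by linarith)))
  rw [integral_eq_of_hasDerivAt_off_countable_of_le
    (fun t => (G t : ℂ)) _ (by linarith) (countable_singleton θ) ?_ ?_
    ((hZ.cauchy hγ hγ1).re.intervalIntegrable hγ θ)]
  · have h₁ : |θ - (θ + π)| = π := by rw [sub_add_cancel_left, abs_neg, abs_of_pos hπ]
    have h₂ : |θ - (θ - π)| = π := by rw [sub_sub_cancel, abs_of_pos hπ]
    rw [hD _ (by linarith) (hz _ (by linarith) h₁.le), hD _ (by linarith) (hz _ (by linarith) h₂.le),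
      ← hper (θ - π), show θ - π + 2 * π = θ + π by ring, Complex.norm_real, Complex.norm_real,
      Real.norm_eq_abs, Real.norm_eq_abs, h₁, h₂, sub_self]
  · intro t ht
    have hpos := hZ.norm_dslope_pos (θ := θ) (t := t)
      (by rw [abs_le]; constructor <;> linarith [ht.1, ht.2])
    have hc := (hZ.continuous_dslope θ).continuousAt (x := t)
    exact (Complex.continuous_ofReal.continuousAt.comp
      (((hc.norm.pow 2).log (pow_ne_zero 2 hpos.ne')).div_const 2).neg).continuousWithinAt
  · rintro t ⟨ht, hne⟩
    have hne : t ≠ θ := hne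
    have hzt := hz t hne (by rw [abs_le]; constructor <;> linarith [ht.1, ht.2])
    have d₁ := hasDerivAt_log_norm_sq ((hZ.hasDerivAt t).const_sub (Z θ)) hzt
    have d₂ := hasDerivAt_log_norm_sq (f := fun t : ℝ => ((θ - t : ℝ) : ℂ)) (f' := ((-1 : ℝ) : ℂ))
      (((hasDerivAt_id t).const_sub θ).ofReal_comp)
      (Complex.ofReal_ne_zero.2 (sub_ne_zero.2 hne.symm))
    have d₃ := (d₂.sub d₁).ofReal_comp
    refine (d₃.congr_deriv ?_).congr_of_eventuallyEq ?_
    · congr 1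
      rw [← Complex.sub_re, cauchyKernel]
      congr 1
      push_cast
      ring
    · have hzc : ∀ᶠ x in nhds t, Z θ - Z x ≠ 0 :=
        (continuous_const.sub hZ.continuous).continuousAt.eventually_ne hzt
      filter_upwards [isOpen_ne.mem_nhds hne, hzc] with x hx hx'
      simp only [hD x hx hx', Pi.sub_apply]

/-! ### The unit circle -/

/-- The standard parametrization of the unit circle. -/
noncomputable def circleCurve (t : ℝ) : ℂ := Complex.exp (t * Complex.I)

theorem circleCurve_periodic : Function.Periodic circleCurve (2 * π) := fun t => by
  simp only [circleCurve]
  push_cast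
  rw [add_mul, Complex.exp_add, Complex.exp_two_pi_mul_I, mul_one]

theorem norm_circleCurve (t : ℝ) : ‖circleCurve t‖ = 1 := Complex.norm_exp_ofReal_mul_I t

theorem circleCurve_sub (a b : ℝ) :
    circleCurve a - circleCurve b = circleCurve b * (circleCurve (a - b) - 1) := by
  rw [mul_sub, mul_one, circleCurve, circleCurve, circleCurve, ← Complex.exp_add]
  congr 2
  push_cast
  ring

theorem norm_circleCurve_sub (a b : ℝ) :
    ‖circleCurve a - circleCurve b‖ = 2 * |Real.sin ((a - b) / 2)| := by
  rw [circleCurve_sub, norm_mul, norm_circleCurve, one_mul, circleCurve, mul_comm,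
    Complex.norm_exp_I_mul_ofReal_sub_one, norm_mul, Real.norm_two, Real.norm_eq_abs]

theorem hasDerivAt_circleCurve (t : ℝ) :
    HasDerivAt circleCurve (Complex.I * circleCurve t) t := by
  have h := ((Complex.ofRealCLM.hasDerivAt (x := t)).mul_const Complex.I).cexp
  refine h.congr_deriv ?_
  simp [circleCurve, mul_comm]

/-- Chords have length 2|sin((a - b)/2)|. The lower constant comes from sin x ≥ (2/π)(x/3) for 0 ≤ x
≤ 3π/4. -/
theorem arcChord_circleCurve (hγ : 0 < γ) (hγ1 : γ < 1) :
    ArcChord γ 2 (2 / (3 * π)) circleCurve (fun t => Complex.I * circleCurve t) where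
  pos := by positivity
  hasDerivAt := hasDerivAt_circleCurve
  continuous_deriv := by unfold circleCurve; fun_prop
  bound t := by rw [norm_mul, Complex.norm_I, norm_circleCurve]; norm_num
  holder a b := by
    rw [← mul_sub, norm_mul, Complex.norm_I, one_mul, norm_circleCurve_sub]
    gcongr
    rcases le_or_gt |a - b| 1 with h | h
    · calc |Real.sin ((a - b) / 2)| ≤ |(a - b) / 2| := Real.abs_sin_le_abs
        _ = |a - b| / 2 := by rw [abs_div, abs_two]
        _ ≤ |a - b| := by linarith [abs_nonneg (a - b)]
        _ ≤ |a - b| ^ γ := Real.self_le_rpow_of_le_one (abs_nonneg _) h hγ1.le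
    · exact (Real.abs_sin_le_one _).trans (Real.one_le_rpow h.le hγ.le)
  lower a b h := by
    have hπ := Real.pi_pos
    rw [norm_circleCurve_sub]
    set x := |a - b| / 2 with hx
    have hx0 : 0 ≤ x := by positivity
    have e : |Real.sin ((a - b) / 2)| = |Real.sin x| := by
      rw [hx]
      rcases abs_cases (a - b) with ⟨h, -⟩ | ⟨h, -⟩ <;> rw [h]
      rw [neg_div, Real.sin_neg, abs_neg]
    have e2 : |a - b| = 2 * x := by rw [hx]; ring
    rw [e, e2]
    have h34 : x ≤ 3 * π / 4 := by linarith
    have key : 2 / π * (x / 3) ≤ Real.sin x := by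
      rcases le_or_gt x (π / 2) with h | h
      · refine le_trans ?_ (Real.mul_le_sin hx0 h)
        gcongr
        linarith
      -- Beyond π/2 reflect: π - x ≥ x/3 exactly when x ≤ 3π/4, which is where the factor 3 arises.
      · rw [← Real.sin_pi_sub]
        refine le_trans ?_ (Real.mul_le_sin (by linarith) (by linarith))
        gcongr
        linarith
    calc 2 / (3 * π) * (2 * x) = 2 * (2 / π * (x / 3)) := by field_simp
      _ ≤ 2 * |Real.sin x| := by gcongr; exact key.trans (le_abs_self _)

theorem re_cauchy_circleCurve (θ t : ℝ) :
    (Complex.I * circleCurve t / (circleCurve θ - circleCurve t)).re =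
      1 / 2 * Real.cot ((θ - t) / 2) := by
  have h0 : circleCurve t ≠ 0 := Complex.exp_ne_zero _
  rw [circleCurve_sub, mul_comm Complex.I, mul_div_mul_left _ _ h0]
  set φ := (θ - t) / 2 with hφ
  have hre : (circleCurve (θ - t) - 1).re = -(2 * Real.sin φ ^ 2) := by
    rw [circleCurve, Complex.sub_re, Complex.exp_ofReal_mul_I_re, Complex.one_re,
      show θ - t = 2 * φ by rw [hφ]; ring, Real.cos_two_mul, Real.cos_sq']
    ring
  have him : (circleCurve (θ - t) - 1).im = 2 * Real.sin φ * Real.cos φ := by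
    rw [circleCurve, Complex.sub_im, Complex.exp_ofReal_mul_I_im, Complex.one_im,
      show θ - t = 2 * φ by rw [hφ]; ring, Real.sin_two_mul, sub_zero]
  rw [Complex.div_re, Complex.normSq_apply, hre, him, Complex.I_re, Complex.I_im, zero_mul,
    zero_div, zero_add, one_mul, Real.cot_eq_cos_div_sin]
  rcases eq_or_ne (Real.sin φ) 0 with h | h
  -- On the diagonal modulo 2π both sides are divisions by zero with value 0, so the identity needs
  -- no exception.
  · simp [h]
  · have hq : -(2 * Real.sin φ ^ 2) * -(2 * Real.sin φ ^ 2) +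
        2 * Real.sin φ * Real.cos φ * (2 * Real.sin φ * Real.cos φ) = 4 * Real.sin φ ^ 2 := by
      rw [show 2 * Real.sin φ * Real.cos φ * (2 * Real.sin φ * Real.cos φ) =
        4 * Real.sin φ ^ 2 * Real.cos φ ^ 2 by ring, Real.cos_sq']
      ring
    rw [hq]
    field_simp
    ring

/-! ### The scalar kernel -/

/-- The real part of the Cauchy kernel of a curve, minus that of the unit circle. -/
noncomputable def scalarKernel (Z Z' : ℝ → ℂ) (θ t : ℝ) : ℂ :=
  ((cauchyKernel Z Z' θ t).re : ℂ) -
    ((cauchyKernel circleCurve (fun t => Complex.I * circleCurve t) θ t).re : ℂ)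

/-- The derivative of `scalarKernel` in its first variable. -/
noncomputable def scalarKernelDeriv (Z Z' : ℝ → ℂ) (θ t : ℝ) : ℂ :=
  ((cauchyKernelDeriv Z Z' θ t).re : ℂ) -
    ((cauchyKernelDeriv circleCurve (fun t => Complex.I * circleCurve t) θ t).re : ℂ)

theorem scalarKernel_eq (Z Z' : ℝ → ℂ) (θ t : ℝ) : scalarKernel Z Z' θ t =
    (((Z' t / (Z θ - Z t)).re - 1 / 2 * Real.cot ((θ - t) / 2) : ℝ) : ℂ) := by
  rw [scalarKernel, cauchyKernel, cauchyKernel, Complex.sub_re, Complex.sub_re,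
    re_cauchy_circleCurve]
  push_cast
  ring

/-- The non-periodic terms 1/(θ - t) of the two Cauchy kernels cancel; in this form periodicity in
both variables is visible. -/
theorem scalarKernel_eq_sub (Z Z' : ℝ → ℂ) (θ t : ℝ) : scalarKernel Z Z' θ t =
    (((Z' t / (Z θ - Z t)).re -
      (Complex.I * circleCurve t / (circleCurve θ - circleCurve t)).re : ℝ) : ℂ) := by
  rw [scalarKernel_eq, re_cauchy_circleCurve]

theorem SingularKernel.mono {M M' : ℝ} {K K₁ : ℝ → ℝ → ℂ} (hK : SingularKernel γ M K K₁)
    (h : M ≤ M') : SingularKernel γ M' K K₁ where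
  measurable := hK.measurable
  measurable_deriv := hK.measurable_deriv
  bound θ t h₁ h₂ := (hK.bound θ t h₁ h₂).trans (by gcongr)
  bound_deriv θ t h₁ h₂ := (hK.bound_deriv θ t h₁ h₂).trans (by gcongr)
  taylor θ η t h₁ h₂ h₃ := (hK.taylor θ η t h₁ h₂ h₃).trans (by gcongr)

theorem ArcChord.scalar (hγ : 0 < γ) (hγ1 : γ < 1) (hZ : ArcChord γ A s Z Z') :
    SingularKernel γ (60 * (1 + (3 * π) ^ 3) * (A / s) ^ 3) (scalarKernel Z Z')
      (scalarKernelDeriv Z Z') := by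
  have hN : 1 ≤ (A / s) ^ 3 := one_le_pow₀ ((one_le_div hZ.pos).2 hZ.le)
  refine ((hZ.cauchy hγ hγ1).re.sub ((arcChord_circleCurve hγ hγ1).cauchy hγ hγ1).re).mono ?_
  have e : (2 : ℝ) / (2 / (3 * π)) = 3 * π := by field_simp
  rw [e]
  have : 0 ≤ (3 * π) ^ 3 := by positivity
  nlinarith [le_mul_of_one_le_right this hN]

theorem ArcChord.integral_scalarKernel (hγ : 0 < γ) (hγ1 : γ < 1) (hZ : ArcChord γ A s Z Z')
    (hper : Function.Periodic Z (2 * π)) (θ : ℝ) :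
    ∫ t in (θ - π)..(θ + π), scalarKernel Z Z' θ t = 0 := by
  have hE := arcChord_circleCurve hγ hγ1
  unfold scalarKernel
  rw [intervalIntegral.integral_sub ((hZ.cauchy hγ hγ1).re.intervalIntegrable hγ θ)
    ((hE.cauchy hγ hγ1).re.intervalIntegrable hγ θ), hZ.integral_re_cauchyKernel hγ hγ1 hper,
    hE.integral_re_cauchyKernel hγ hγ1 circleCurve_periodic, sub_self]

theorem scalarKernel_periodic (hper : Function.Periodic Z (2 * π))
    (hper' : Function.Periodic Z' (2 * π)) (θ : ℝ) :
    Function.Periodic (scalarKernel Z Z' θ) (2 * π) := fun t => by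
  simp only [scalarKernel_eq_sub, hper t, hper' t, circleCurve_periodic t]

theorem tensorKernel_periodic (hper : Function.Periodic Z (2 * π))
    (hper' : Function.Periodic Z' (2 * π)) (θ : ℝ) :
    Function.Periodic (tensorKernel Z Z' θ) (2 * π) := fun t => by
  simp only [tensorKernel, hper t, hper' t]

end

section

/-! ### Hölder spaces on the circle -/

theorem periodic_iteratedDeriv {f : ℝ → Plane} {c : ℝ} (hf : Function.Periodic f c) (l : ℕ) :
    Function.Periodic (iteratedDeriv l f) c := by
  induction l with
  | zero => rwa [iteratedDeriv_zero]
  | succ l ih =>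
    intro t
    rw [iteratedDeriv_succ, ← deriv_comp_add_const]
    congr 1
    funext s
    exact ih s

theorem norm_le_iSup_of_periodic {g : ℝ → Plane} (hg : Function.Periodic g (2 * π))
    (hc : Continuous g) (t : ℝ) : ‖g t‖ ≤ ⨆ θ : ℝ, ‖g θ‖ := by
  obtain ⟨R, hR⟩ := (hg.isBounded_of_continuous (by positivity) hc).exists_norm_le
  refine le_ciSup (f := fun θ => ‖g θ‖) ⟨R, ?_⟩ t
  rintro _ ⟨θ, rfl⟩
  exact hR _ ⟨θ, rfl⟩

theorem MemHolderSpace.continuous_iteratedDeriv {k l : ℕ} {γ : ℝ} {f : ℝ → Plane}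
    (hf : MemHolderSpace k γ f) (hl : l ≤ k) : Continuous (iteratedDeriv l f) :=
  hf.2.1.continuous_iteratedDeriv l (by exact_mod_cast hl)

theorem holderSeminorm_nonneg (γ : ℝ) (f : ℝ → Plane) : 0 ≤ holderSeminorm γ f := by
  refine Real.sSup_nonneg ?_
  rintro _ ⟨θ, θ', -, -, rfl⟩
  positivity

theorem ckNorm_nonneg (k : ℕ) (f : ℝ → Plane) : 0 ≤ ckNorm k f :=
  Finset.sum_nonneg fun _ _ => Real.iSup_nonneg fun _ => norm_nonneg _

theorem holderNorm_nonneg (k : ℕ) (γ : ℝ) (f : ℝ → Plane) : 0 ≤ holderNorm k γ f :=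
  add_nonneg (ckNorm_nonneg k f) (holderSeminorm_nonneg γ _)

theorem MemHolderSpace.norm_iteratedDeriv_le {k l : ℕ} {γ : ℝ} {f : ℝ → Plane}
    (hf : MemHolderSpace k γ f) (hl : l ≤ k) (t : ℝ) :
    ‖iteratedDeriv l f t‖ ≤ holderNorm k γ f := by
  refine (norm_le_iSup_of_periodic (periodic_iteratedDeriv hf.1 l)
    (hf.continuous_iteratedDeriv hl) t).trans ?_
  refine le_trans ?_ (le_add_of_nonneg_right (holderSeminorm_nonneg γ _))
  exact Finset.single_le_sum (f := fun l => ⨆ θ : ℝ, ‖iteratedDeriv l f θ‖)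
    (fun _ _ => Real.iSup_nonneg fun _ => norm_nonneg _)
    (Finset.mem_range.2 (Nat.lt_succ_of_le hl))

/-- At distance below 1 lowering the exponent weakens the Hölder bound; at distance at least 1 the
supremum suffices. The smaller exponent β serves the critical case. -/
theorem MemHolderSpace.norm_sub_le {k : ℕ} {γ β : ℝ} {f : ℝ → Plane}
    (hf : MemHolderSpace k γ f) (hβ : 0 < β) (hβγ : β ≤ γ) (a b : ℝ) :
    ‖iteratedDeriv k f a - iteratedDeriv k f b‖ ≤ 2 * holderNorm k γ f * |a - b| ^ β := by
  have hH := holderNorm_nonneg k γ f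
  rcases eq_or_ne a b with rfl | hne
  · rw [sub_self, norm_zero]; positivity
  have hpos : 0 < |a - b| := abs_pos.2 (sub_ne_zero.2 hne)
  rcases lt_or_ge |a - b| 1 with h | h
  · obtain ⟨K, hK⟩ := hf.2.2
    have hle : ‖iteratedDeriv k f a - iteratedDeriv k f b‖ / |a - b| ^ γ ≤
        holderSeminorm γ (iteratedDeriv k f) := by
      -- The Hölder constant from membership makes the set of quotients bounded above, so the real
      -- supremum is not a default value.
      refine le_csSup ⟨K, ?_⟩ ⟨a, b, hne, h, rfl⟩
      rintro _ ⟨θ, θ', hne', -, rfl⟩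
      have : 0 < |θ - θ'| := abs_pos.2 (sub_ne_zero.2 hne')
      rw [div_le_iff₀ (by positivity)]
      exact hK θ θ'
    rw [div_le_iff₀ (by positivity)] at hle
    have h₁ : holderSeminorm γ (iteratedDeriv k f) ≤ 2 * holderNorm k γ f :=
      (le_add_of_nonneg_left (ckNorm_nonneg k f)).trans (by rw [← holderNorm]; linarith)
    have h₂ : |a - b| ^ γ ≤ |a - b| ^ β := Real.rpow_le_rpow_of_exponent_ge hpos h.le hβγ
    exact hle.trans (by gcongr)
  · have h₁ : 1 ≤ |a - b| ^ β := Real.one_le_rpow h hβ.le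
    refine (norm_sub_le_of_le (hf.norm_iteratedDeriv_le le_rfl a)
      (hf.norm_iteratedDeriv_le le_rfl b)).trans ?_
    rw [← two_mul]
    exact le_mul_of_one_le_right (by positivity) h₁

/-- Past half a period the circle distance is 2π - |a - b|. The factor 1/3 is attained at |a - b| =
3π/2, where that distance is π/2. -/
theorem le_dist_addCircle {a b : ℝ} (h : |a - b| ≤ 3 * π / 2) :
    |a - b| / 3 ≤ dist (a : AddCircle (2 * π)) (b : AddCircle (2 * π)) := by
  have hπ := Real.pi_pos
  have h2π : |2 * π| / 2 = π := by rw [abs_of_pos (by positivity)]; ring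
  have key : ∀ x : ℝ, |x| ≤ π → ‖(x : AddCircle (2 * π))‖ = |x| := fun x hx =>
    (AddCircle.norm_coe_eq_abs_iff (2 * π) (by positivity)).2 (by rwa [h2π])
  rw [dist_eq_norm, ← AddCircle.coe_sub]
  rcases le_or_gt |a - b| π with h₁ | h₁
  · rw [key _ h₁]; linarith [abs_nonneg (a - b)]
  · rcases le_total 0 (a - b) with h₀ | h₀
    · rw [abs_of_nonneg h₀] at h h₁ ⊢
      have h₂ : |a - b - 2 * π| = 2 * π - (a - b) := by
        rw [abs_of_nonpos (by linarith)]; ring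
      have e : ((a - b : ℝ) : AddCircle (2 * π)) = ((a - b - 2 * π : ℝ) : AddCircle (2 * π)) := by
        rw [AddCircle.coe_sub (2 * π) (a - b), AddCircle.coe_period, sub_zero]
      rw [e, key _ (by rw [h₂]; linarith), h₂]
      linarith
    · rw [abs_of_nonpos h₀] at h h₁ ⊢
      have h₂ : |a - b + 2 * π| = 2 * π + (a - b) := by
        rw [abs_of_nonneg (by linarith)]; ring
      have e : ((a - b : ℝ) : AddCircle (2 * π)) = ((a - b + 2 * π : ℝ) : AddCircle (2 * π)) := by
        rw [AddCircle.coe_add_period]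
      rw [e, key _ (by rw [h₂]; linarith), h₂]
      linarith

theorem starNorm_mul_dist_le (X : ℝ → Plane) {a b : ℝ}
    (h : (a : AddCircle (2 * π)) ≠ (b : AddCircle (2 * π))) :
    starNorm X * dist (a : AddCircle (2 * π)) (b : AddCircle (2 * π)) ≤ ‖X a - X b‖ := by
  rw [← le_div_iff₀ (dist_pos.2 h)]
  refine csInf_le ⟨0, ?_⟩ ⟨a, b, h, rfl⟩
  rintro _ ⟨θ, θ', -, rfl⟩
  positivity

theorem starNorm_lower (X : ℝ → Plane) (hX : 0 < starNorm X) {a b : ℝ}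
    (h : |a - b| ≤ 3 * π / 2) : starNorm X / 3 * |a - b| ≤ ‖X a - X b‖ := by
  have hd := le_dist_addCircle h
  rcases eq_or_ne (a : AddCircle (2 * π)) (b : AddCircle (2 * π)) with he | he
  · rw [he, dist_self] at hd
    have : |a - b| = 0 := le_antisymm (by linarith) (abs_nonneg _)
    rw [this, mul_zero]
    exact norm_nonneg _
  · calc starNorm X / 3 * |a - b| = starNorm X * (|a - b| / 3) := by ring
      _ ≤ starNorm X * dist (a : AddCircle (2 * π)) (b : AddCircle (2 * π)) := by gcongr
      _ ≤ _ := starNorm_mul_dist_le X he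

/-! ### From pointwise estimates to membership in Hölder spaces -/

theorem holderSeminorm_le {γ C : ℝ} {f : ℝ → Plane} (hC : 0 ≤ C)
    (h : ∀ a b, a ≠ b → |a - b| ≤ 1 → ‖f a - f b‖ ≤ C * |a - b| ^ γ) :
    holderSeminorm γ f ≤ C := by
  refine Real.sSup_le ?_ hC
  rintro _ ⟨a, b, hne, hlt, rfl⟩
  have : 0 < |a - b| := abs_pos.2 (sub_ne_zero.2 hne)
  rw [div_le_iff₀ (by positivity)]
  exact h a b hne hlt.le

/-- A bounded function with a local Hölder estimate satisfies a global one. -/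
theorem holder_of_local {γ C : ℝ} (hγ : 0 < γ) {f : ℝ → Plane}
    (hb : ∀ t, ‖f t‖ ≤ C) (h : ∀ a b, a ≠ b → |a - b| ≤ 1 → ‖f a - f b‖ ≤ C * |a - b| ^ γ)
    (a b : ℝ) : ‖f a - f b‖ ≤ 2 * C * |a - b| ^ γ := by
  have hC : 0 ≤ C := (norm_nonneg _).trans (hb 0)
  rcases eq_or_ne a b with rfl | hne
  · rw [sub_self, norm_zero]; positivity
  rcases le_or_gt |a - b| 1 with hl | hl
  · refine (h a b hne hl).trans ?_
    gcongr
    linarith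
  · refine (norm_sub_le_of_le (hb a) (hb b)).trans ?_
    rw [← two_mul]
    exact le_mul_of_one_le_right (by positivity) (Real.one_le_rpow hl.le hγ.le)

theorem continuous_of_holder {γ C : ℝ} (hγ : 0 < γ) {f : ℝ → Plane}
    (h : ∀ a b, ‖f a - f b‖ ≤ C * |a - b| ^ γ) : Continuous f := by
  rw [continuous_iff_continuousAt]
  intro b
  have hc : Continuous fun a : ℝ => C * |a - b| ^ γ :=
    continuous_const.mul ((continuous_abs.comp (continuous_id.sub continuous_const)).rpow_const
      fun _ => Or.inr hγ.le)
  have ht := hc.tendsto b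
  rw [sub_self, abs_zero, Real.zero_rpow hγ.ne', mul_zero] at ht
  exact tendsto_iff_norm_sub_tendsto_zero.2
    (squeeze_zero (fun _ => norm_nonneg _) (fun a => h a b) ht)

theorem memHolderSpace_zero {γ C : ℝ} (hγ : 0 < γ) {f : ℝ → Plane}
    (hper : Function.Periodic f (2 * π)) (hb : ∀ t, ‖f t‖ ≤ C)
    (h : ∀ a b, a ≠ b → |a - b| ≤ 1 → ‖f a - f b‖ ≤ C * |a - b| ^ γ) :
    MemHolderSpace 0 γ f ∧ holderNorm 0 γ f ≤ 2 * C := by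
  have hC : 0 ≤ C := (norm_nonneg _).trans (hb 0)
  have hg := holder_of_local hγ hb h
  refine ⟨⟨hper, ?_, 2 * C, ?_⟩, ?_⟩
  · rw [Nat.cast_zero]
    exact contDiff_zero.2 (continuous_of_holder hγ hg)
  · simpa only [iteratedDeriv_zero] using hg
  · have h₁ := holderSeminorm_le hC h
    have h₂ : ⨆ θ : ℝ, ‖f θ‖ ≤ C := ciSup_le hb
    simp only [holderNorm, ckNorm, zero_add, Finset.sum_range_one, iteratedDeriv_zero]
    linarith

theorem hasDerivAt_of_taylor {γ C : ℝ} (hγ : 1 < γ) {f : ℝ → Plane} {D : Plane} {θ : ℝ}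
    (h : ∀ η, θ ≠ η → |η - θ| ≤ 1 → ‖f η - f θ - (η - θ) • D‖ ≤ C * |η - θ| ^ γ) :
    HasDerivAt f D θ := by
  rw [hasDerivAt_iff_isLittleO, Asymptotics.isLittleO_iff]
  intro c hc
  have hcont : Continuous fun η : ℝ => C * |η - θ| ^ (γ - 1) :=
    continuous_const.mul ((continuous_abs.comp (continuous_id.sub continuous_const)).rpow_const
      fun _ => Or.inr (by linarith))
  have ht := hcont.tendsto θ
  rw [sub_self, abs_zero, Real.zero_rpow (by linarith), mul_zero] at ht
  filter_upwards [ht.eventually (eventually_le_nhds hc), Metric.closedBall_mem_nhds θ one_pos]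
    with η h₁ h₂
  rcases eq_or_ne θ η with rfl | hne
  · simp
  have hpos : 0 < |η - θ| := abs_pos.2 (sub_ne_zero.2 hne.symm)
  refine (h η hne h₂).trans ?_
  rw [Real.norm_eq_abs]
  calc C * |η - θ| ^ γ = C * |η - θ| ^ (γ - 1) * |η - θ| := by
        rw [Real.rpow_sub_one hpos.ne']; field_simp
    _ ≤ c * |η - θ| := by gcongr

/-- Since γ > 1 the expansion makes D the derivative. Adding the expansions at a toward b and at b
toward a leaves (a - b)(D(a) - D(b)), and dividing by |a - b| gives the Hölder bound on D. -/
theorem memHolderSpace_one {γ C : ℝ} (hγ : 1 < γ) {f D : ℝ → Plane}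
    (hper : Function.Periodic f (2 * π)) (hb : ∀ t, ‖f t‖ ≤ C) (hD : ∀ t, ‖D t‖ ≤ C)
    (h : ∀ θ η, θ ≠ η → |η - θ| ≤ 1 → ‖f η - f θ - (η - θ) • D θ‖ ≤ C * |η - θ| ^ γ) :
    MemHolderSpace 1 (γ - 1) f ∧ holderNorm 1 (γ - 1) f ≤ 4 * C := by
  have hC : 0 ≤ C := (norm_nonneg _).trans (hb 0)
  have hder : ∀ θ, HasDerivAt f (D θ) θ := fun θ => hasDerivAt_of_taylor hγ (h θ)
  have hderiv : deriv f = D := funext fun θ => (hder θ).deriv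
  have hl : ∀ a b, a ≠ b → |a - b| ≤ 1 → ‖D a - D b‖ ≤ 2 * C * |a - b| ^ (γ - 1) := by
    intro a b hne hab
    have hpos : 0 < |a - b| := abs_pos.2 (sub_ne_zero.2 hne)
    have h₁ := h a b hne (by rwa [abs_sub_comm])
    have h₂ := h b a hne.symm hab
    rw [abs_sub_comm] at h₁
    have e : (a - b) • (D a - D b) =
        (f b - f a - (b - a) • D a) + (f a - f b - (a - b) • D b) := by
      rw [smul_sub, ← neg_sub a b, neg_smul]; abel
    have h₃ : |a - b| * ‖D a - D b‖ ≤ 2 * C * |a - b| ^ γ := by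
      rw [← Real.norm_eq_abs, ← norm_smul, e]
      exact (norm_add_le_of_le h₁ h₂).trans (le_of_eq (by rw [Real.norm_eq_abs]; ring))
    rw [Real.rpow_sub_one hpos.ne', ← mul_div_assoc, le_div_iff₀ hpos, mul_comm]
    exact h₃
  have hD' : ∀ t, ‖D t‖ ≤ 2 * C := fun t => (hD t).trans (by linarith)
  have hg := holder_of_local (by linarith : 0 < γ - 1) hD' hl
  refine ⟨⟨hper, ?_, 2 * (2 * C), ?_⟩, ?_⟩
  · rw [Nat.cast_one, contDiff_one_iff_deriv, hderiv]
    exact ⟨fun θ => (hder θ).differentiableAt, continuous_of_holder (by linarith) hg⟩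
  · simpa only [iteratedDeriv_one, hderiv] using hg
  · have h₁ := holderSeminorm_le (by linarith) hl
    have h₂ : ⨆ θ : ℝ, ‖f θ‖ ≤ C := ciSup_le hb
    have h₃ : ⨆ θ : ℝ, ‖D θ‖ ≤ C := ciSup_le hD
    simp only [holderNorm, ckNorm, Finset.sum_range_succ, Finset.sum_range_zero, zero_add,
      iteratedDeriv_zero, iteratedDeriv_one, hderiv]
    linarith

end

section

/-! ### The plane as the complex line -/

/-- The isometry of the Euclidean plane with the complex plane. -/
noncomputable def toComplex : Plane ≃ₗᵢ[ℝ] ℂ := Complex.orthonormalBasisOneI.repr.symm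

theorem toComplex_apply (x : Plane) : toComplex x = (x 0 : ℂ) + (x 1 : ℂ) * Complex.I := by
  rw [toComplex, ← Complex.orthonormalBasisOneI.sum_repr_symm, Fin.sum_univ_two,
    Complex.coe_orthonormalBasisOneI]
  simp

theorem toComplex_re (x : Plane) : (toComplex x).re = x 0 := by simp [toComplex_apply]

theorem toComplex_im (x : Plane) : (toComplex x).im = x 1 := by simp [toComplex_apply]

theorem MemHolderSpace.mono_arcChord {γ β : ℝ} {X : ℝ → Plane} (hX : MemHolderSpace 1 γ X)
    (hs : 0 < starNorm X) (hβ : 0 < β) (hβγ : β ≤ γ) :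
    ArcChord β (2 * holderNorm 1 γ X) (starNorm X / 3) (fun t => toComplex (X t))
      (fun t => toComplex (deriv X t)) where
  pos := by positivity
  hasDerivAt t := by
    have hd : HasDerivAt X (deriv X t) t :=
      ((hX.2.1.differentiable (by norm_num)) t).hasDerivAt
    exact (toComplex.toContinuousLinearEquiv.toContinuousLinearMap.hasFDerivAt.comp_hasDerivAt t hd)
  continuous_deriv := by
    have h := hX.continuous_iteratedDeriv le_rfl
    rw [iteratedDeriv_one] at h
    exact toComplex.continuous.comp h
  bound t := by
    have h := hX.norm_iteratedDeriv_le le_rfl t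
    rw [iteratedDeriv_one] at h
    rw [toComplex.norm_map]
    linarith [holderNorm_nonneg 1 γ X]
  holder a b := by
    have h := hX.norm_sub_le hβ hβγ a b
    rw [iteratedDeriv_one] at h
    rwa [← map_sub, toComplex.norm_map]
  lower a b h := by
    rw [← map_sub, toComplex.norm_map]
    exact starNorm_lower X hs h

theorem MemHolderSpace.holderDensity {γ β : ℝ} {u : ℝ → Plane} (hu : MemHolderSpace 0 γ u)
    (hβ : 0 < β) (hβγ : β ≤ γ) :
    HolderDensity β (2 * holderNorm 0 γ u) (fun t => toComplex (u t)) where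
  continuous := by
    have h := hu.continuous_iteratedDeriv le_rfl
    rw [iteratedDeriv_zero] at h
    exact toComplex.continuous.comp h
  bound t := by
    have h := hu.norm_iteratedDeriv_le le_rfl t
    rw [iteratedDeriv_zero] at h
    rw [toComplex.norm_map]
    linarith [holderNorm_nonneg 0 γ u]
  holder a b := by
    have h := hu.norm_sub_le hβ hβγ a b
    rw [iteratedDeriv_zero] at h
    rwa [← map_sub, toComplex.norm_map]

theorem HolderDensity.conj {β B : ℝ} {u : ℝ → ℂ} (hu : HolderDensity β B u) :
    HolderDensity β B (fun t => conj (u t)) where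
  continuous := Complex.continuous_conj.comp hu.continuous
  bound t := by rw [Complex.norm_conj]; exact hu.bound t
  holder a b := by rw [← map_sub, Complex.norm_conj]; exact hu.holder a b

/-! ### Functions represented by singular integrals -/

/-- The function `f` is a periodic singular integral with a kernel of mean zero. -/
def IsSingularIntegral (β M B : ℝ) (f : ℝ → Plane) : Prop :=
  Function.Periodic f (2 * π) ∧
    ∃ (c : ℝ) (K K₁ : ℝ → ℝ → ℂ) (v : ℝ → ℂ), |c| ≤ 1 ∧ SingularKernel β M K K₁ ∧
      (∀ θ, Function.Periodic (K θ) (2 * π)) ∧ (∀ θ, ∫ t in (θ - π)..(θ + π), K θ t = 0) ∧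
      HolderDensity β B v ∧ Function.Periodic v (2 * π) ∧
      ∀ θ, toComplex (f θ) = c * ∫ t in (θ - π)..(θ + π), K θ t * v t

theorem norm_ofReal_mul_le {c : ℝ} (hc : |c| ≤ 1) (z : ℂ) : ‖(c : ℂ) * z‖ ≤ ‖z‖ := by
  rw [norm_mul, Complex.norm_real, Real.norm_eq_abs]
  exact mul_le_of_le_one_left (norm_nonneg z) hc

theorem IsSingularIntegral.memHolderSpace_of_lt_half {β : ℝ} (hβ : 0 < β) (hβ2 : β < 1 / 2) :
    ∃ C : ℝ, ∀ (M B : ℝ) (f : ℝ → Plane), IsSingularIntegral β M B f →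
      MemHolderSpace 0 (2 * β) f ∧ holderNorm 0 (2 * β) f ≤ C * (M * B) := by
  obtain ⟨C, hC, h⟩ := SingularKernel.holder_of_lt_half hβ hβ2
  set C₀ := 2 * π ^ β / β with hC₀
  have hC₀0 : 0 ≤ C₀ := by positivity
  refine ⟨2 * (C₀ + C), ?_⟩
  rintro M B f ⟨hper, c, K, K₁, v, hc, hK, hKper, hKzero, hv, hvper, hf⟩
  have hMB : 0 ≤ M * B := mul_nonneg hK.nonneg hv.nonneg
  have := memHolderSpace_zero (γ := 2 * β) (C := (C₀ + C) * (M * B)) (by linarith) hper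
    (fun θ => ?_) (fun η θ hne hd => ?_)
  · exact ⟨this.1, this.2.trans (le_of_eq (by ring))⟩
  · rw [← toComplex.norm_map, hf]
    refine (norm_ofReal_mul_le hc _).trans ((hK.norm_integral_le hβ hv θ).trans ?_)
    gcongr
    linarith
  · rw [← toComplex.norm_map, map_sub, hf, hf, ← mul_sub,
      hK.sub_eq hβ hKper hKzero hv.continuous hvper]
    refine (norm_ofReal_mul_le hc _).trans ((h M B K K₁ v hK hv θ η hne.symm hd).trans ?_)
    gcongr
    linarith

theorem IsSingularIntegral.memHolderSpace_of_half_lt {β : ℝ} (hβ : 1 / 2 < β) (hβ1 : β < 1) :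
    ∃ C : ℝ, ∀ (M B : ℝ) (f : ℝ → Plane), IsSingularIntegral β M B f →
      MemHolderSpace 1 (2 * β - 1) f ∧ holderNorm 1 (2 * β - 1) f ≤ C * (M * B) := by
  have hβ0 : 0 < β := by linarith
  obtain ⟨C, hC, h⟩ := SingularKernel.taylor_of_half_lt hβ hβ1
  set C₀ := 2 * π ^ β / β with hC₀
  have hC₀0 : 0 ≤ C₀ := by positivity
  refine ⟨4 * (C₀ + C), ?_⟩
  rintro M B f ⟨hper, c, K, K₁, v, hc, hK, hKper, hKzero, hv, hvper, hf⟩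
  have hMB : 0 ≤ M * B := mul_nonneg hK.nonneg hv.nonneg
  choose D hD hT using h M B K K₁ v hK hv
  have := memHolderSpace_one (γ := 2 * β) (C := (C₀ + C) * (M * B)) (by linarith) hper
    (D := fun θ => toComplex.symm (c * D θ)) (fun θ => ?_) (fun θ => ?_)
    (fun θ η hne hd => ?_)
  · exact ⟨this.1, this.2.trans (le_of_eq (by ring))⟩
  · rw [← toComplex.norm_map, hf]
    refine (norm_ofReal_mul_le hc _).trans ((hK.norm_integral_le hβ0 hv θ).trans ?_)
    gcongr
    linarith
  · rw [LinearIsometryEquiv.norm_map]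
    refine (norm_ofReal_mul_le hc _).trans ((hD θ).trans ?_)
    gcongr
    linarith
  · rw [← toComplex.norm_map, map_sub, map_sub, map_smul, LinearIsometryEquiv.apply_symm_apply,
      hf, hf, ← mul_sub, hK.sub_eq hβ0 hKper hKzero hv.continuous hvper, Complex.real_smul,
      mul_left_comm, ← mul_sub]
    refine (norm_ofReal_mul_le hc _).trans ((hT θ η hne hd).trans ?_)
    gcongr
    linarith

/-! ### The two operators -/

theorem toComplex_integrandC (X u : ℝ → Plane) (θ t : ℝ) : toComplex (integrandC X u θ t) =
    scalarKernel (fun t => toComplex (X t)) (fun t => toComplex (deriv X t)) θ t *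
      toComplex (u t) := by
  rw [integrandC, map_smul, Complex.real_smul, scalarKernel_eq, kernelC, re_div_eq_inner,
    ← map_sub, toComplex.inner_map_map, toComplex.norm_map]

/-- The projection onto the line of x is half the sum of the identity and the reflection in that
line, and the reflection is u ↦ (z/z̄) ū for the complex number z of x. -/
theorem entries_eq (x : Plane) (hx : x ≠ 0) :
    x 0 * x 0 / ‖x‖ ^ 2 = (1 + (toComplex x / conj (toComplex x)).re) / 2 ∧
    x 0 * x 1 / ‖x‖ ^ 2 = (toComplex x / conj (toComplex x)).im / 2 ∧
    x 1 * x 1 / ‖x‖ ^ 2 = (1 - (toComplex x / conj (toComplex x)).re) / 2 := by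
  have hn : ‖x‖ ^ 2 = x 0 * x 0 + x 1 * x 1 := by
    rw [← toComplex.norm_map, ← Complex.normSq_eq_norm_sq, Complex.normSq_apply, toComplex_re,
      toComplex_im]
  have hne : x 0 * x 0 + x 1 * x 1 ≠ 0 := by
    rw [← hn]; exact pow_ne_zero 2 (norm_ne_zero_iff.2 hx)
  have hne' : x 0 ^ 2 + x 1 ^ 2 ≠ 0 := by rwa [sq, sq]
  rw [hn, Complex.div_re, Complex.div_im, Complex.normSq_conj, Complex.normSq_apply,
    Complex.conj_re, Complex.conj_im, toComplex_re, toComplex_im]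
  refine ⟨?_, ?_, ?_⟩ <;> field_simp <;> ring

theorem kernelT_eq {X : ℝ → Plane} {θ t : ℝ} {k : ℂ} (hc : Continuous X) (hne : X θ - X t ≠ 0)
    (hk : HasDerivAt (fun t => (toComplex (X θ) - toComplex (X t)) /
      conj (toComplex (X θ) - toComplex (X t))) k t) :
    kernelT X θ t 0 0 = k.re / 2 ∧ kernelT X θ t 0 1 = k.im / 2 ∧
      kernelT X θ t 1 0 = k.im / 2 ∧ kernelT X θ t 1 1 = -k.re / 2 := by
  have hre := (Complex.reCLM.hasFDerivAt.comp_hasDerivAt t hk)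
  have him := (Complex.imCLM.hasFDerivAt.comp_hasDerivAt t hk)
  have hev : ∀ᶠ s in nhds t, X θ - X s ≠ 0 :=
    (continuous_const.sub hc).continuousAt.eventually_ne hne
  refine ⟨?_, ?_, ?_, ?_⟩
  · refine (((hre.const_add 1).div_const 2).congr_of_eventuallyEq ?_).deriv
    filter_upwards [hev] with s hs
    rw [(entries_eq _ hs).1, map_sub]
    rfl
  · refine ((him.div_const 2).congr_of_eventuallyEq ?_).deriv
    filter_upwards [hev] with s hs
    rw [(entries_eq _ hs).2.1, map_sub]
    rfl
  · refine ((him.div_const 2).congr_of_eventuallyEq ?_).deriv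
    filter_upwards [hev] with s hs
    rw [mul_comm, (entries_eq _ hs).2.1, map_sub]
    rfl
  · refine (((hre.const_sub 1).div_const 2).congr_of_eventuallyEq ?_).deriv
    filter_upwards [hev] with s hs
    rw [(entries_eq _ hs).2.2, map_sub]
    rfl

theorem toComplex_integrandT {X u : ℝ → Plane} {θ t : ℝ} {k : ℂ} (hc : Continuous X)
    (hne : X θ - X t ≠ 0)
    (hk : HasDerivAt (fun t => (toComplex (X θ) - toComplex (X t)) /
      conj (toComplex (X θ) - toComplex (X t))) k t) :
    toComplex (integrandT X u θ t) = k * conj (toComplex (u t)) * (1 / 2 : ℝ) := by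
  obtain ⟨h₀₀, h₀₁, h₁₀, h₁₁⟩ := kernelT_eq hc hne hk
  have e₀ : (integrandT X u θ t) 0 = k.re / 2 * (u t) 0 + k.im / 2 * (u t) 1 := by
    rw [← h₀₀, ← h₀₁]
    simp [integrandT]
  have e₁ : (integrandT X u θ t) 1 = k.im / 2 * (u t) 0 + -k.re / 2 * (u t) 1 := by
    rw [← h₁₀, ← h₁₁]
    simp [integrandT]
  apply Complex.ext
  · rw [toComplex_re, e₀, Complex.re_mul_ofReal, Complex.mul_re, Complex.conj_re, Complex.conj_im,
      toComplex_re, toComplex_im]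
    ring
  · rw [toComplex_im, e₁, Complex.im_mul_ofReal, Complex.mul_im, Complex.conj_re, Complex.conj_im,
      toComplex_re, toComplex_im]
    ring

variable {γ β : ℝ} {X u : ℝ → Plane}

theorem integrandC_periodic (hX : Function.Periodic X (2 * π)) (hu : Function.Periodic u (2 * π))
    (θ : ℝ) : Function.Periodic (integrandC X u θ) (2 * π) := by
  intro t
  apply toComplex.injective
  have hX' := periodic_iteratedDeriv hX 1
  rw [iteratedDeriv_one] at hX'
  simp only [toComplex_integrandC, hu t]
  rw [scalarKernel_periodic (fun t => by simp only [hX t]) (fun t => by simp only [hX' t])]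

theorem integrandC_add_period (hX : Function.Periodic X (2 * π)) (θ : ℝ) :
    integrandC X u (θ + 2 * π) = integrandC X u θ := by
  funext t
  apply toComplex.injective
  simp only [toComplex_integrandC, scalarKernel_eq_sub, hX θ, circleCurve_periodic θ]

theorem integrandT_periodic (hX : Function.Periodic X (2 * π)) (hu : Function.Periodic u (2 * π))
    (θ : ℝ) : Function.Periodic (integrandT X u θ) (2 * π) := by
  intro t
  have hK : kernelT X θ (t + 2 * π) = kernelT X θ t := by
    ext i j
    simp only [kernelT, Matrix.of_apply]
    rw [← deriv_comp_add_const]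
    simp only [hX _]
  simp only [integrandT, hu t, hK]

theorem integrandT_add_period (hX : Function.Periodic X (2 * π)) (θ : ℝ) :
    integrandT X u (θ + 2 * π) = integrandT X u θ := by
  funext t
  simp only [integrandT, kernelT, hX θ]

/-- The integrals over a period and over a period centered at `θ` agree, with integrability. -/
theorem integral_period_of_ae_eq {f : ℝ → Plane} {g : ℝ → ℂ} (hf : Function.Periodic f (2 * π))
    (θ : ℝ) (hg : IntervalIntegrable g volume (θ - π) (θ + π))
    (h : ∀ t ∈ Ioc (θ - π) (θ + π), t ≠ θ → toComplex (f t) = g t) :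
    IntervalIntegrable f volume 0 (2 * π) ∧
      toComplex (∫ t in (0 : ℝ)..(2 * π), f t) = ∫ t in (θ - π)..(θ + π), g t := by
  have hπ := Real.pi_pos
  have hθ : ∀ᵐ t : ℝ, t ≠ θ := by simp [ae_iff, measure_singleton]
  have hae : ∀ᵐ t : ℝ, t ∈ uIoc (θ - π) (θ + π) → g t = toComplex (f t) := by
    rw [uIoc_of_le (by linarith)]
    filter_upwards [hθ] with t h₁ h₂ using (h t h₂ h₁).symm
  let T : ℂ →L[ℝ] Plane := toComplex.symm.toContinuousLinearEquiv.toContinuousLinearMap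
  have hT : ∀ z, T z = toComplex.symm z := fun _ => rfl
  have hint : IntervalIntegrable f volume (θ - π) (θ + π) := by
    have h₁ : IntervalIntegrable (fun t => T (g t)) volume (θ - π) (θ + π) :=
      ⟨T.integrable_comp hg.1, T.integrable_comp hg.2⟩
    refine h₁.congr_ae ?_
    rw [Filter.EventuallyEq, ae_restrict_iff' measurableSet_uIoc]
    filter_upwards [hae] with t ht hmem
    rw [ht hmem, hT, LinearIsometryEquiv.symm_apply_apply]
  have hcent : ∫ t in (0 : ℝ)..(2 * π), f t = ∫ t in (θ - π)..(θ + π), f t := by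
    have := hf.intervalIntegral_add_eq 0 (θ - π)
    rwa [zero_add, show θ - π + 2 * π = θ + π by ring] at this
  refine ⟨hf.intervalIntegrable (t := θ - π) (by positivity)
    (by rwa [show θ - π + 2 * π = θ + π by ring]) _ _, ?_⟩
  rw [hcent, intervalIntegral.integral_congr_ae hae]
  exact (toComplex.toContinuousLinearEquiv.toContinuousLinearMap.intervalIntegral_comp_comm
    hint).symm

theorem integral_integrandC (hβ : 0 < β) (hβ1 : β < 1) (hβγ : β ≤ γ) (hX : MemHolderSpace 1 γ X)
    (hs : 0 < starNorm X) (hu : MemHolderSpace 0 γ u) (θ : ℝ) :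
    IntervalIntegrable (integrandC X u θ) volume 0 (2 * π) ∧
      toComplex (∫ t in (0 : ℝ)..(2 * π), integrandC X u θ t) =
        ∫ t in (θ - π)..(θ + π), scalarKernel (fun t => toComplex (X t))
          (fun t => toComplex (deriv X t)) θ t * toComplex (u t) :=
  integral_period_of_ae_eq (integrandC_periodic hX.1 hu.1 θ) θ
    (((hX.mono_arcChord hs hβ hβγ).scalar hβ hβ1).intervalIntegrable_mul hβ
      (hu.holderDensity hβ hβγ).continuous θ)
    fun t _ _ => toComplex_integrandC X u θ t

theorem integral_integrandT (hβ : 0 < β) (hβ1 : β < 1) (hβγ : β ≤ γ) (hX : MemHolderSpace 1 γ X)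
    (hs : 0 < starNorm X) (hu : MemHolderSpace 0 γ u) (θ : ℝ) :
    IntervalIntegrable (integrandT X u θ) volume 0 (2 * π) ∧
      toComplex (∫ t in (0 : ℝ)..(2 * π), integrandT X u θ t) =
        (∫ t in (θ - π)..(θ + π), tensorKernel (fun t => toComplex (X t))
          (fun t => toComplex (deriv X t)) θ t * conj (toComplex (u t))) * ((1 / 2 : ℝ) : ℂ) := by
  have hZ := hX.mono_arcChord hs hβ hβγ
  have hint := (hZ.tensor hβ hβ1).intervalIntegrable_mul hβ
    (hu.holderDensity hβ hβγ).conj.continuous θ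
  rw [← intervalIntegral.integral_mul_const]
  refine integral_period_of_ae_eq (integrandT_periodic hX.1 hu.1 θ) θ (hint.mul_const _) ?_
  intro t ht hne
  have hH : 0 < |θ - t| := abs_pos.2 (sub_ne_zero.2 hne.symm)
  have hp := hZ.pos
  have hz : toComplex (X θ) - toComplex (X t) ≠ 0 :=
    norm_pos_iff.1 (lt_of_lt_of_le (by positivity)
      (hZ.lower θ t (by linarith [abs_sub_le_pi ht, Real.pi_pos])))
  have hz' : X θ - X t ≠ 0 := fun h => hz (by rw [← map_sub, h, map_zero])
  exact toComplex_integrandT hX.2.1.continuous hz' (hZ.hasDerivAt_ratio hz)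

theorem abs_inv_four_pi_le : |-(1 / (4 * π))| ≤ 1 := by
  have hπ := Real.pi_gt_three
  rw [abs_neg, abs_of_pos (by positivity), div_le_one (by positivity)]
  linarith

theorem isSingularIntegral_opC (hβ : 0 < β) (hβ1 : β < 1) (hβγ : β ≤ γ)
    (hX : MemHolderSpace 1 γ X) (hs : 0 < starNorm X) (hu : MemHolderSpace 0 γ u) :
    IsSingularIntegral β
      (60 * (1 + (3 * π) ^ 3) * (2 * holderNorm 1 γ X / (starNorm X / 3)) ^ 3)
      (2 * holderNorm 0 γ u) (opC X u) := by
  have hZ := hX.mono_arcChord hs hβ hβγ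
  have hX' := periodic_iteratedDeriv hX.1 1
  rw [iteratedDeriv_one] at hX'
  refine ⟨fun θ => by simp only [opC, integrandC_add_period hX.1], -(1 / (4 * π)), _, _, _,
    abs_inv_four_pi_le, hZ.scalar hβ hβ1, scalarKernel_periodic (fun t => by simp only [hX.1 t])
    (fun t => by simp only [hX' t]), hZ.integral_scalarKernel hβ hβ1
    (fun t => by simp only [hX.1 t]), hu.holderDensity hβ hβγ, fun t => by simp only [hu.1 t],
    fun θ => ?_⟩
  rw [opC, map_smul, (integral_integrandC hβ hβ1 hβγ hX hs hu θ).2, Complex.real_smul]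

theorem isSingularIntegral_opT (hβ : 0 < β) (hβ1 : β < 1) (hβγ : β ≤ γ)
    (hX : MemHolderSpace 1 γ X) (hs : 0 < starNorm X) (hu : MemHolderSpace 0 γ u) :
    IsSingularIntegral β
      (60 * (1 + (3 * π) ^ 3) * (2 * holderNorm 1 γ X / (starNorm X / 3)) ^ 3)
      (2 * holderNorm 0 γ u) (opT X u) := by
  have hZ := hX.mono_arcChord hs hβ hβγ
  have hX' := periodic_iteratedDeriv hX.1 1
  rw [iteratedDeriv_one] at hX'
  have hH := holderNorm_nonneg 1 γ X
  have hπ := Real.pi_pos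
  refine ⟨fun θ => by simp only [opT, integrandT_add_period hX.1], -(1 / (4 * π)) * (1 / 2),
    _, _, _, ?_, (hZ.tensor hβ hβ1).mono ?_, tensorKernel_periodic (fun t => by simp only [hX.1 t])
    (fun t => by simp only [hX' t]), hZ.integral_tensorKernel hβ hβ1
    (fun t => by simp only [hX.1 t]), (hu.holderDensity hβ hβγ).conj,
    fun t => by simp only [hu.1 t], fun θ => ?_⟩
  · rw [abs_mul, abs_of_pos (show (0 : ℝ) < 1 / 2 by norm_num)]
    linarith [abs_inv_four_pi_le]
  · have h₁ : 0 ≤ (2 * holderNorm 1 γ X / (starNorm X / 3)) ^ 3 := by positivity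
    have h₂ : 0 ≤ (3 * π) ^ 3 := by positivity
    nlinarith [mul_nonneg h₁ h₂]
  · rw [opT, map_smul, (integral_integrandT hβ hβ1 hβγ hX hs hu θ).2, Complex.real_smul]
    push_cast
    ring

end

end Peskin

/-! ### Conclusion: the three ranges of the exponent -/

open Peskin in
theorem mainTheorem6 (γ : ℝ) (hγ : γ ∈ Set.Ioo (0 : ℝ) 1) :
    (∀ X u : ℝ → Peskin.Plane, Peskin.MemHolderSpace 1 γ X → 0 < Peskin.starNorm X →
      Peskin.MemHolderSpace 0 γ u → ∀ θ : ℝ,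
        IntervalIntegrable (Peskin.integrandC X u θ) volume 0 (2 * π) ∧
        IntervalIntegrable (Peskin.integrandT X u θ) volume 0 (2 * π)) ∧
    (γ ≠ 1 / 2 → ∃ C : ℝ, ∀ X u : ℝ → Peskin.Plane,
      Peskin.MemHolderSpace 1 γ X → 0 < Peskin.starNorm X → Peskin.MemHolderSpace 0 γ u →
        (Peskin.MemHolderSpace ⌊2 * γ⌋₊ (2 * γ - ⌊2 * γ⌋₊) (Peskin.opC X u) ∧
          Peskin.holderNorm ⌊2 * γ⌋₊ (2 * γ - ⌊2 * γ⌋₊) (Peskin.opC X u) ≤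
            C * (Peskin.holderNorm 1 γ X / Peskin.starNorm X) ^ 3 * Peskin.holderNorm 0 γ u) ∧
        (Peskin.MemHolderSpace ⌊2 * γ⌋₊ (2 * γ - ⌊2 * γ⌋₊) (Peskin.opT X u) ∧
          Peskin.holderNorm ⌊2 * γ⌋₊ (2 * γ - ⌊2 * γ⌋₊) (Peskin.opT X u) ≤
            C * (Peskin.holderNorm 1 γ X / Peskin.starNorm X) ^ 3 * Peskin.holderNorm 0 γ u)) ∧
    (γ = 1 / 2 → ∀ α ∈ Set.Ioo (0 : ℝ) 1, ∃ C : ℝ, ∀ X u : ℝ → Peskin.Plane,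
      Peskin.MemHolderSpace 1 γ X → 0 < Peskin.starNorm X → Peskin.MemHolderSpace 0 γ u →
        (Peskin.MemHolderSpace 0 α (Peskin.opC X u) ∧
          Peskin.holderNorm 0 α (Peskin.opC X u) ≤
            C * (Peskin.holderNorm 1 γ X / Peskin.starNorm X) ^ 3 * Peskin.holderNorm 0 γ u) ∧
        (Peskin.MemHolderSpace 0 α (Peskin.opT X u) ∧
          Peskin.holderNorm 0 α (Peskin.opT X u) ≤
            C * (Peskin.holderNorm 1 γ X / Peskin.starNorm X) ^ 3 * Peskin.holderNorm 0 γ u)) := by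
  obtain ⟨hγ0, hγ1⟩ := hγ
  -- The 2's come from passing to global Hölder bounds and the 3 from comparing circle and line
  -- distances.
  have hconst : ∀ C a b c : ℝ,
      C * (60 * (1 + (3 * π) ^ 3) * (2 * a / (b / 3)) ^ 3 * (2 * c)) =
        C * (60 * (1 + (3 * π) ^ 3) * 6 ^ 3 * 2) * (a / b) ^ 3 * c := fun C a b c => by
    rw [show 2 * a / (b / 3) = 6 * (a / b) by rw [div_div_eq_mul_div]; ring]
    ring
  refine ⟨fun X u hX hs hu θ => ⟨(integral_integrandC hγ0 hγ1 le_rfl hX hs hu θ).1,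
    (integral_integrandT hγ0 hγ1 le_rfl hX hs hu θ).1⟩, fun hne => ?_, fun hγ α hα => ?_⟩
  · rcases lt_or_gt_of_ne hne with h | h
    · obtain ⟨C, hC⟩ := IsSingularIntegral.memHolderSpace_of_lt_half hγ0 h
      have hfl : ⌊2 * γ⌋₊ = 0 := Nat.floor_eq_zero.2 (by linarith)
      rw [hfl, Nat.cast_zero, sub_zero]
      refine ⟨C * (60 * (1 + (3 * π) ^ 3) * 6 ^ 3 * 2), fun X u hX hs hu => ?_⟩
      rw [← hconst]
      exact ⟨hC _ _ _ (isSingularIntegral_opC hγ0 hγ1 le_rfl hX hs hu),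
        hC _ _ _ (isSingularIntegral_opT hγ0 hγ1 le_rfl hX hs hu)⟩
    · obtain ⟨C, hC⟩ := IsSingularIntegral.memHolderSpace_of_half_lt h hγ1
      have hfl : ⌊2 * γ⌋₊ = 1 := by
        rw [Nat.floor_eq_iff (by linarith)]
        constructor <;> norm_num <;> linarith
      rw [hfl, Nat.cast_one]
      refine ⟨C * (60 * (1 + (3 * π) ^ 3) * 6 ^ 3 * 2), fun X u hX hs hu => ?_⟩
      rw [← hconst]
      exact ⟨hC _ _ _ (isSingularIntegral_opC hγ0 hγ1 le_rfl hX hs hu),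
        hC _ _ _ (isSingularIntegral_opT hγ0 hγ1 le_rfl hX hs hu)⟩
  · obtain ⟨hα0, hα1⟩ := hα
    -- Regard X and u as Hölder of exponent α/2 < 1/2 = γ; the subcritical gain then gives exponent
    -- 2 · (α/2) = α.
    have hβ0 : 0 < α / 2 := by linarith
    have hβ1 : α / 2 < 1 / 2 := by linarith
    obtain ⟨C, hC⟩ := IsSingularIntegral.memHolderSpace_of_lt_half hβ0 hβ1
    rw [mul_div_cancel₀ α two_ne_zero] at hC
    refine ⟨C * (60 * (1 + (3 * π) ^ 3) * 6 ^ 3 * 2), fun X u hX hs hu => ?_⟩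
    rw [← hconst]
    exact ⟨hC _ _ _ (isSingularIntegral_opC hβ0 (by linarith) (by linarith) hX hs hu),
      hC _ _ _ (isSingularIntegral_opT hβ0 (by linarith) (by linarith) hX hs hu)⟩
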